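/- Let $n\ge 0$ be an integer. Let $E\subset\mathbb{R}^{n+1}$ be the hyperplane of vectors with coordinate sum zero, with simple roots $\alpha_i=\varepsilon_i-\varepsilon_{i+1}$ and fundamental weights $\varpi_1,\dots,\varpi_n\in E$ defined by $(\varpi_i,\alpha_j)=\delta_{ij}$. For $\lambda\in E$ let $\mathsf{P}_n(\lambda)\subset E$ be the permutohedron, i.e. the convex hull of the orbit of $\lambda$ under permutations of the coordinates, and let $\mathrm{Vol}_n$ be the Euclidean volume on $E$. For integers $1\le i,j\le d$ put $c_{d,i,j}=\min\{i,j\}-\frac{ij}{d+1}$ (the $(i,j)$ entry of the inverse of the Cartan matrix of type $A_d$), and for $u\ge 0$ let $$\Gamma_{d,i}[u]=\frac1d\binom{d+1}{i}\sum_{j=1}^{d}c_{d,i,j}\,x_{j+u}\in\mathbb{R}[x_1,x_2,\dots].$$ An $n$-Dyck path is a lattice path from $(0,0)$ to $(n,n)$ with $n$ north steps $(0,1)$ and $n$ east steps $(1,0)$ that never goes below the diagonal $y=x$; let $\mathcal{D}_n$ be the set of all of them. For a north step $N$ of $D\in\mathcal{D}_n$ with initial point $P_N=(u,u')$, let $D_N$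 be the part of $D$ from $P_N$ to $(n,n)$, translated by $-P_N$, and let $K$ be the (non-empty) set of integers $1\le k\le n-u$ such that $D_N$ passes through $(k,k)$ and its part from $(0,0)$ to $(k,k)$ is a $k$-Dyck path. With $d=\max K$ and $i=\min K$, set $c_N=c_{d,i,i}$ and $\Gamma_N=\Gamma_{d,i}[u]$. Finally let $c_D=\prod_{N\in D}c_N$ and $\Gamma_D=\prod_{N\in D}\Gamma_N$, the products being over all north steps of $D$. Then: 1. $c_D=\dfrac{1}{n+1}$ for every $D\in\mathcal{D}_n$. 2. There is a unique polynomial $\mathcal{V}_n\in\mathbb{R}[x_1,x_2,\dots]$ such that $\mathcal{V}_n(x_1,x_2,\dots)=\mathrm{Vol}_n\big(\mathsf{P}_n(x_1\varpi_1+\cdots+x_n\varpi_n)\big)$ whenever $x_1,\dots,x_n\ge 0$, and it is $$\mathcal{V}_n=\sqrt{n+1}\,\sum_{D\in\mathcal{D}_n}\Gamma_D .$$ 3. Equivalently, if the volume on $E$ is instead normalized (as Postnikov does) so that the parallelepiped spanned by the simple roots $\alpha_1,\dots,\alpha_n$ has volume $1$, then for all $x_1,\dots,x_n\ge 0$ the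 volume of $\mathsf{P}_n(x_1\varpi_1+\cdots+x_n\varpi_n)$ is $\sum_{D\in\mathcal{D}_n}\Gamma_D(x_1,\dots,x_n)$. -/

import Mathlib

open MeasureTheory

noncomputable section

namespace DyckVolume

/-! ### The permutohedron in type `A_n` -/

/-- The hyperplane `E ⊆ ℝ^{n+1}` of vectors with coordinate sum zero, with the Euclidean
inner product. -/
abbrev E (n : ℕ) : Submodule ℝ (EuclideanSpace ℝ (Fin (n + 1))) where
  carrier := {v | ∑ k, v k = 0}
  add_mem' := by
    intro a b ha hb
    simp only [Set.mem_ofPred_eq, PiLp.add_apply, Finset.sum_add_distrib] at *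
    rw [ha, hb, add_zero]
  zero_mem' := by simp
  smul_mem' := by
    intro c a ha
    simp only [Set.mem_ofPred_eq, PiLp.smul_apply, smul_eq_mul, ← Finset.mul_sum] at *
    rw [ha, mul_zero]

/-- The simple root `α_{i+1} = ε_{i+1} - ε_{i+2}` (the index `i : Fin n` starts at `0`). -/
def simpleRoot (n : ℕ) (i : Fin n) : E n :=
  ⟨EuclideanSpace.single i.castSucc 1 - EuclideanSpace.single i.succ 1, by
    simp [Finset.sum_sub_distrib]⟩

/-- The fundamental weight `ϖ_{i+1}` (the index `i : Fin n` starts at `0`):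
its first `i + 1` coordinates are `1 - (i+1)/(n+1)`, the others are `-(i+1)/(n+1)`. -/
def fundamentalWeight (n : ℕ) (i : Fin n) : E n :=
  ⟨WithLp.toLp 2 fun k : Fin (n + 1) =>
      (if k ≤ i.castSucc then 1 else 0) - ((i : ℝ) + 1) / ((n : ℝ) + 1), by
    have h : (Finset.univ.filter fun k : Fin (n + 1) => k ≤ i.castSucc).card = (i : ℕ) + 1 := by
      have : (Finset.univ.filter fun k : Fin (n + 1) => k ≤ i.castSucc)
          = Finset.Iic i.castSucc := by ext; simp
      rw [this, Fin.card_Iic]; simp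
    have hn : (n : ℝ) + 1 ≠ 0 := by positivity
    simp only [Submodule.mem_mk, AddSubmonoid.mem_mk, AddSubsemigroup.mem_mk, Set.mem_ofPred_eq,
      Finset.sum_sub_distrib, Finset.sum_boole, h, Finset.sum_const, Finset.card_univ,
      Fintype.card_fin, nsmul_eq_mul]
    push_cast
    field_simp
    ring⟩

/-- The fundamental weights are dual to the simple roots: `(ϖ_i, α_j) = δ_{ij}`. -/
theorem inner_fundamentalWeight_simpleRoot (n : ℕ) (i j : Fin n) :
    inner ℝ (fundamentalWeight n i) (simpleRoot n j) = if i = j then 1 else 0 := by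
  rw [Submodule.coe_inner]
  simp only [fundamentalWeight, simpleRoot, inner_sub_right, EuclideanSpace.inner_single_right,
    Fin.le_def, Fin.val_castSucc, Fin.val_succ, Fin.ext_iff]
  by_cases h : (i : ℕ) = j
  · simp [h]
  · rcases lt_or_gt_of_ne h with h' | h'
    · have h1 : ¬ ((j : ℕ) ≤ i) := by omega
      have h2 : ¬ ((j : ℕ) + 1 ≤ i) := by omega
      simp [h, h1, h2]
    · have h1 : ((j : ℕ) ≤ i) := by omega
      have h2 : ((j : ℕ) + 1 ≤ i) := by omega
      simp [h, h1, h2]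

/-- The action of the Weyl group `𝔖_{n+1}` on `E` by permutation of the coordinates. -/
def permute {n : ℕ} (w : Equiv.Perm (Fin (n + 1))) (v : E n) : E n :=
  ⟨WithLp.toLp 2 fun k => (v : EuclideanSpace ℝ (Fin (n + 1))) (w.symm k), by
    have hv : ∑ k, (v : EuclideanSpace ℝ (Fin (n + 1))) k = 0 := v.2
    simp only [Submodule.mem_mk, AddSubmonoid.mem_mk, AddSubsemigroup.mem_mk, Set.mem_ofPred_eq]
    rw [← hv]
    exact Equiv.sum_comp w.symm fun k => (v : EuclideanSpace ℝ (Fin (n + 1))) k⟩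

/-- The permutohedron `P_n(v)`: the convex hull of the Weyl group orbit of `v`. -/
def permutohedron {n : ℕ} (v : E n) : Set (E n) :=
  convexHull ℝ (Set.range fun w : Equiv.Perm (Fin (n + 1)) => permute w v)

/-- The vector `x_1 ϖ_1 + ⋯ + x_n ϖ_n`. -/
def weightVector (n : ℕ) (x : ℕ → ℝ) : E n :=
  ∑ i : Fin n, x (i + 1) • fundamentalWeight n i

/-- The Euclidean (`n`-dimensional) volume on `E`: the translation invariant measure for which the
parallelepiped spanned by an orthonormal basis of `E` has measure `1`. (The bare `volume` is
avoided, since on a subspace it could mean the restriction of the ambient measure.) -/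
def euclideanVolume (n : ℕ) : Measure (E n) :=
  (stdOrthonormalBasis ℝ (E n)).toBasis.addHaar

/-- `V` is the volume polynomial `𝒱_n` of the permutohedron:
`V(x_1, x_2, …) = Vol_n (P_n (x_1 ϖ_1 + ⋯ + x_n ϖ_n))` for all `x_1, …, x_n ≥ 0`.
Polynomials live in `ℝ[x_1, x_2, …]`; the variable `x_j` is `X j`, and `X 0` is never used. -/
def IsVolumePolynomial (n : ℕ) (V : MvPolynomial ℕ ℝ) : Prop :=
  ∀ x : ℕ → ℝ, (∀ j ∈ Finset.Icc 1 n, 0 ≤ x j) →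
    MvPolynomial.eval x V = (euclideanVolume n).real (permutohedron (weightVector n x))

/-! ### The linear forms `Γ_{d,i}` -/

/-- `c_{d,i,j} = min {i,j} - i j / (d+1)`, the `(i,j)` entry, `1 ≤ i, j ≤ d`, of the inverse of the
Cartan matrix of type `A_d`. -/
def cartanInv (d i j : ℕ) : ℝ := (min i j : ℕ) - (i : ℝ) * j / ((d : ℝ) + 1)

theorem cartanMatrix_inv_apply (d : ℕ) (i j : Fin d) :
    ((CartanMatrix.A d).map (Int.cast : ℤ → ℝ))⁻¹ i j = cartanInv d (i + 1) (j + 1) := by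
  have key : (CartanMatrix.A d).map (Int.cast : ℤ → ℝ) *
      Matrix.of (fun i j : Fin d => cartanInv d (i + 1) (j + 1)) = 1 := by
    ext i j
    have hd : (d : ℝ) + 1 ≠ 0 := by positivity
    have hi := i.2
    have hj := j.2
    have e : ∀ k : Fin d, (((CartanMatrix.A d i k : ℤ)) : ℝ) * cartanInv d (k + 1) (j + 1) =
        (((if (k : ℕ) = i then 2 * cartanInv d (k + 1) (j + 1) else 0)
          - (if (k : ℕ) = i + 1 then cartanInv d (k + 1) (j + 1) else 0))
          - (if (k : ℕ) + 1 = i then cartanInv d (k + 1) (j + 1) else 0)) := by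
      intro k
      simp only [CartanMatrix.A, Matrix.of_apply, Fin.ext_iff]
      split_ifs <;> first | omega | (push_cast; ring)
    have s1 : ∑ k ∈ Finset.range d,
        (if k = (i : ℕ) + 1 then cartanInv d (k + 1) (j + 1) else 0)
        = cartanInv d (i + 2) (j + 1) := by
      rw [Finset.sum_ite_eq']
      split_ifs with h
      · rfl
      · have h' : (i : ℕ) + 2 = d + 1 := by rw [Finset.mem_range] at h; omega
        rw [h', cartanInv, min_eq_right (by omega)]
        push_cast
        field_simp
        ring
    have s2 : ∑ k ∈ Finset.range d,
        (if k + 1 = (i : ℕ) then cartanInv d (k + 1) (j + 1) else 0)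
        = cartanInv d i (j + 1) := by
      rcases Nat.eq_zero_or_pos (i : ℕ) with h | h
      · rw [h]; simp [cartanInv]
      · rw [Finset.sum_eq_single ((i : ℕ) - 1)]
        · rw [Nat.sub_add_cancel h]; simp
        · intro b _ hb
          exact if_neg (by omega)
        · intro hb; rw [Finset.mem_range] at hb; omega
    rw [Matrix.mul_apply]
    simp only [Matrix.map_apply, Matrix.of_apply, e, Finset.sum_sub_distrib]
    rw [Fin.sum_univ_eq_sum_range
        (fun k => if k = (i : ℕ) then 2 * cartanInv d (k + 1) (j + 1) else 0),
      Fin.sum_univ_eq_sum_range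
        (fun k => if k = (i : ℕ) + 1 then cartanInv d (k + 1) (j + 1) else 0),
      Fin.sum_univ_eq_sum_range
        (fun k => if k + 1 = (i : ℕ) then cartanInv d (k + 1) (j + 1) else 0), s1, s2,
      Finset.sum_ite_eq', if_pos (Finset.mem_range.2 hi), Matrix.one_apply]
    simp only [cartanInv, Fin.ext_iff]
    rcases lt_trichotomy (i : ℕ) j with h | h | h
    · rw [if_neg (by omega), min_eq_left (by omega), min_eq_left (by omega),
        min_eq_left (by omega)]
      push_cast
      ring
    · rw [if_pos h, ← h, min_eq_left (by omega), min_eq_right (by omega),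
        min_eq_left (by omega)]
      push_cast
      ring
    · rw [if_neg (by omega), min_eq_right (by omega), min_eq_right (by omega),
        min_eq_right (by omega)]
      push_cast
      ring
  rw [Matrix.inv_eq_right_inv key, Matrix.of_apply]

/-- `Γ_{d,i} = (1/d) * binom(d+1, i) * ∑_{j=1}^d c_{d,i,j} x_j`. -/
def gammaForm (d i : ℕ) : MvPolynomial ℕ ℝ :=
  MvPolynomial.C (1 / (d : ℝ) * ((d + 1).choose i : ℝ)) *
    ∑ j ∈ Finset.Icc 1 d, MvPolynomial.C (cartanInv d i j) * MvPolynomial.X j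

/-- The shift `p[u](x_1, x_2, …) = p(x_{1+u}, x_{2+u}, …)`. -/
def shift (u : ℕ) (p : MvPolynomial ℕ ℝ) : MvPolynomial ℕ ℝ :=
  MvPolynomial.rename (fun j => j + u) p

/-! ### Dyck paths -/

/-- `n`-Dyck paths, as Dyck words: the letter `U` is a north step, the letter `D` an east step. -/
abbrev DyckPath (n : ℕ) : Type := {p : DyckWord // p.semilength = n}

namespace DyckPath

variable {n : ℕ}

/-- The positions (counted from `0`) in the word at which the path makes a north step. -/
def northSteps (D : DyckPath n) : Finset ℕ :=
  (Finset.range D.1.toList.length).filter fun t => D.1.toList[t]? = some DyckStep.U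

/-- The abscissa `u` of the point at which the step at position `t` starts. -/
def abscissa (D : DyckPath n) (t : ℕ) : ℕ := (D.1.toList.take t).count DyckStep.D

/-- For the step `N` at position `t`, with initial point `P_N = (u, u')`: the set `K` of
`1 ≤ k ≤ n - u` for which the remaining path `D_N`, translated to start at the origin, passes
through `(k,k)` and its part from `(0,0)` to `(k,k)` is a `k`-Dyck path. -/
def returnSet (D : DyckPath n) (t : ℕ) : Set ℕ :=
  {k | 1 ≤ k ∧ k ≤ n - D.abscissa t ∧
    ∃ q : DyckPath k, q.1.toList <+: D.1.toList.drop t}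

/-- `d = max K`. -/
def maxReturn (D : DyckPath n) (t : ℕ) : ℕ := sSup (D.returnSet t)

/-- `i = min K`. -/
def minReturn (D : DyckPath n) (t : ℕ) : ℕ := sInf (D.returnSet t)

/-- `c_D`, the product of `c_N = c_{d,i,i}` over the north steps `N` of `D`. -/
def cartanProd (D : DyckPath n) : ℝ :=
  ∏ t ∈ D.northSteps, cartanInv (D.maxReturn t) (D.minReturn t) (D.minReturn t)

/-- `Γ_D`, the product of `Γ_N = Γ_{d,i}[u]` over the north steps `N` of `D`. -/
def gammaPoly (D : DyckPath n) : MvPolynomial ℕ ℝ :=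
  ∏ t ∈ D.northSteps, shift (D.abscissa t) (gammaForm (D.maxReturn t) (D.minReturn t))

end DyckPath

end DyckVolume

end

/-!
By Rado's theorem the permutohedron of `l_0 ≥ ⋯ ≥ l_n` is cut out by the majorization inequalities.
Forget one coordinate and slice by a second one: for `l_{j+1} ≤ t ≤ l_j` the slice at `t` is the
projected permutohedron of the sequence in which `l_j, l_{j+1}` are merged into
`l_j + l_{j+1} - t`. The volumes are therefore the polynomials given by `q_0 = 1` and
`q_{n+1}(l) = ∑_j ∫ q_n(…, l_{j-1}, s, l_{j+2}, …) ds` over `l_{j+1} ≤ s ≤ l_j`. By Pascal's rule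
the derivative of `q_{n+1}` in the direction `ε_k - ε_{k+1}` is `binom(n+2, k+1)` times the product
of `q_k(l_0, …, l_k)` and `q_{n-k}(l_{k+1}, …, l_{n+1})`. As `q_{n+1}` is homogeneous of degree
`n + 1` and translation invariant, Euler's identity recovers it from these derivatives, and the
resulting recursion is the decomposition of Dyck paths at the first return.
-/

noncomputable section

namespace DyckVolume

open Finset.HasAntidiagonal (antidiagonal mem_antidiagonal)

/-! ### The first return of a Dyck path -/

/-- The positive semilengths of the Dyck words that are prefixes of `l`: the set `K` of a north step
when `l` is the part of the path that starts there. -/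
def dyckPrefixes (l : List DyckStep) : Set ℕ :=
  {k | 1 ≤ k ∧ ∃ q : DyckWord, q.semilength = k ∧ q.toList <+: l}

/-- The factor `f u d i` attached to the position `t` of a word `l` if that position holds a north
step, where `u` is the abscissa of the step and `d`, `i` are the maximum and the minimum of its set
of returns; it is `1` at the other positions. -/
def stepFactor {M : Type*} [CommMonoid M] (f : ℕ → ℕ → ℕ → M) (l : List DyckStep) (t : ℕ) : M :=
  if l[t]? = some DyckStep.U then
    f ((l.take t).count DyckStep.D) (sSup (dyckPrefixes (l.drop t)))
      (sInf (dyckPrefixes (l.drop t)))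
  else 1

/-- The product of the factors `f u d i` over the north steps of a Dyck word. -/
def stepProd {M : Type*} [CommMonoid M] (f : ℕ → ℕ → ℕ → M) (p : DyckWord) : M :=
  ∏ t ∈ Finset.range p.toList.length, stepFactor f p.toList t

theorem DyckPath.returnSet_eq_dyckPrefixes {n : ℕ} (D : DyckPath n) (t : ℕ) :
    D.returnSet t = dyckPrefixes (D.1.toList.drop t) := by
  ext k
  refine and_congr_right fun hk => ⟨fun ⟨_, q, hq⟩ => ⟨q.1, q.2, hq⟩, fun ⟨q, hqk, hq⟩ =>
    ⟨?_, ⟨q, hqk⟩, hq⟩⟩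
  have hcount := hq.count_le DyckStep.D
  have htotal :
      (D.1.toList.take t).count DyckStep.D + (D.1.toList.drop t).count DyckStep.D = n := by
    rw [← List.count_append, List.take_append_drop, ← DyckWord.semilength_eq_count_D, D.2]
  rw [← DyckWord.semilength_eq_count_D, hqk] at hcount
  unfold DyckPath.abscissa
  omega

theorem DyckPath.prod_northSteps {n : ℕ} {M : Type*} [CommMonoid M] (f : ℕ → ℕ → ℕ → M)
    (D : DyckPath n) :
    ∏ t ∈ D.northSteps, f (D.abscissa t) (D.maxReturn t) (D.minReturn t) = stepProd f D.1 := by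
  simp only [DyckPath.northSteps, Finset.prod_filter, stepProd, stepFactor, DyckPath.abscissa,
    DyckPath.maxReturn, DyckPath.minReturn, DyckPath.returnSet_eq_dyckPrefixes]

theorem count_U_drop_le_count_D_drop (p : DyckWord) (t : ℕ) :
    (p.toList.drop t).count DyckStep.U ≤ (p.toList.drop t).count DyckStep.D := by
  have htotal := p.count_U_eq_count_D
  rw [← List.take_append_drop t p.toList, List.count_append, List.count_append] at htotal
  have htake := p.count_D_le_count_U t
  omega

theorem count_D_le_count_U_of_prefix {q : DyckWord} {l : List DyckStep} (h : l <+: q.toList) :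
    l.count DyckStep.D ≤ l.count DyckStep.U := by
  rw [List.prefix_iff_eq_take.1 h]
  exact q.count_D_le_count_U _

theorem prefix_drop_of_prefix_drop_append {p q : DyckWord} {t : ℕ} {l : List DyckStep}
    (h : q.toList <+: p.toList.drop t ++ DyckStep.D :: l) : q.toList <+: p.toList.drop t := by
  have hnot : ¬ p.toList.drop t ++ [DyckStep.D] <+: q.toList := fun hq => by
    have hcount := count_D_le_count_U_of_prefix hq
    have hdrop := count_U_drop_le_count_D_drop p t
    simp only [List.count_append, List.count_singleton_self,
      List.count_singleton, beq_iff_eq, reduceCtorEq, if_false] at hcount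
    omega
  have hD : p.toList.drop t ++ [DyckStep.D] <+: p.toList.drop t ++ DyckStep.D :: l :=
    (List.prefix_append_right_inj _).2 (by simp)
  rcases List.prefix_concat_iff.1 ((List.prefix_or_prefix_of_prefix h hD).resolve_right hnot) with
    heq | hpre
  · exact absurd (heq ▸ List.prefix_rfl) hnot
  · exact hpre

theorem dyckPrefixes_drop_append (p : DyckWord) (t : ℕ) (l : List DyckStep) :
    dyckPrefixes (p.toList.drop t ++ DyckStep.D :: l) = dyckPrefixes (p.toList.drop t) := by
  ext k
  exact and_congr_right fun _ => exists_congr fun q => and_congr_right fun _ =>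
    ⟨prefix_drop_of_prefix_drop_append, fun h => h.trans (List.prefix_append _ _)⟩

theorem toList_nest_add (p q : DyckWord) :
    (p.nest + q).toList = DyckStep.U :: (p.toList ++ DyckStep.D :: q.toList) := by
  change ([DyckStep.U] ++ p.toList ++ [DyckStep.D]) ++ q.toList = _
  simp

theorem semilength_nest_add (p q : DyckWord) :
    (p.nest + q).semilength = p.semilength + q.semilength + 1 := by
  rw [DyckWord.semilength_add, DyckWord.semilength_nest, add_right_comm]

theorem sSup_dyckPrefixes {p : DyckWord} (hp : 1 ≤ p.semilength) :
    sSup (dyckPrefixes p.toList) = p.semilength := by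
  refine IsGreatest.csSup_eq ⟨⟨hp, p, rfl, List.prefix_rfl⟩, ?_⟩
  rintro k ⟨-, q, rfl, h⟩
  exact h.count_le _

theorem sInf_dyckPrefixes_nest_add (p q : DyckWord) :
    sInf (dyckPrefixes (p.nest + q).toList) = p.semilength + 1 := by
  refine IsLeast.csInf_eq ⟨⟨by omega, p.nest, by simp, List.prefix_append _ _⟩, ?_⟩
  rintro k ⟨hpos, r, rfl, h⟩
  by_contra! hlt
  rw [toList_nest_add] at h
  have hrlen := r.two_mul_semilength_eq_length
  have hplen := p.two_mul_semilength_eq_length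
  cases hr : r.toList with
  | nil => rw [hr, List.length_nil] at hrlen; omega
  | cons a s =>
    rw [hr, List.cons_prefix_cons] at h
    rw [hr, List.length_cons] at hrlen
    obtain ⟨rfl, h⟩ := h
    have hs : s <+: p.toList :=
      List.prefix_of_prefix_length_le h (List.prefix_append _ _) (by omega)
    have hcount := count_D_le_count_U_of_prefix hs
    have hbalance := r.count_U_eq_count_D
    rw [hr, List.count_cons_self, List.count_cons_of_ne (by decide)] at hbalance
    omega

section StepProd

variable {M : Type*} [CommMonoid M] (f : ℕ → ℕ → ℕ → M)

theorem stepFactor_nest_zero (p q : DyckWord) :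
    stepFactor f (p.nest + q).toList 0 =
      f 0 (p.semilength + q.semilength + 1) (p.semilength + 1) := by
  have hU : (p.nest + q).toList[0]? = some DyckStep.U := by simp [toList_nest_add]
  rw [stepFactor, if_pos hU, List.drop_zero, List.take_zero, List.count_nil,
    sInf_dyckPrefixes_nest_add, sSup_dyckPrefixes (by rw [semilength_nest_add]; omega),
    semilength_nest_add]

theorem stepFactor_inside (p q : DyckWord) {t : ℕ} (ht : t < p.toList.length) :
    stepFactor f (p.nest + q).toList (t + 1) = stepFactor f p.toList t := by
  simp only [stepFactor, toList_nest_add, List.getElem?_cons_succ, List.take_succ_cons,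
    List.drop_succ_cons, List.getElem?_append_left ht, List.take_append_of_le_length ht.le,
    List.drop_append_of_le_length ht.le, dyckPrefixes_drop_append,
    List.count_cons_of_ne (show DyckStep.U ≠ DyckStep.D by decide)]

theorem stepFactor_inside_length (p q : DyckWord) :
    stepFactor f (p.nest + q).toList (p.toList.length + 1) = 1 := by
  simp [stepFactor, toList_nest_add]

theorem stepFactor_outside (p q : DyckWord) (t : ℕ) :
    stepFactor f (p.nest + q).toList (p.toList.length + (t + 1) + 1) =
      stepFactor (fun u => f (u + (p.semilength + 1))) q.toList t := by
  simp only [stepFactor, toList_nest_add, List.getElem?_cons_succ, List.take_succ_cons,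
    List.drop_succ_cons, List.getElem?_append_right (Nat.le_add_right _ _), List.take_append,
    List.drop_append, List.take_of_length_le (Nat.le_add_right p.toList.length (t + 1)),
    List.drop_of_length_le (Nat.le_add_right p.toList.length (t + 1)), Nat.add_sub_cancel_left,
    List.nil_append, List.count_cons_of_ne (show DyckStep.U ≠ DyckStep.D by decide),
    List.count_append, List.count_cons_self, ← DyckWord.semilength_eq_count_D]
  rw [add_left_comm]

theorem stepProd_zero : stepProd f 0 = 1 := rfl

theorem stepProd_nest_add (p q : DyckWord) :
    stepProd f (p.nest + q) = f 0 (p.semilength + q.semilength + 1) (p.semilength + 1) *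
      stepProd f p * stepProd (fun u => f (u + (p.semilength + 1))) q := by
  have hlen : (p.nest + q).toList.length = p.toList.length + (q.toList.length + 1) + 1 := by
    simp [toList_nest_add]
  unfold stepProd
  rw [hlen, Finset.prod_range_succ', Finset.prod_range_add, Finset.prod_range_succ',
    stepFactor_nest_zero, add_zero, stepFactor_inside_length, mul_one,
    Finset.prod_congr rfl fun t ht => stepFactor_inside f p q (Finset.mem_range.1 ht),
    Finset.prod_congr rfl fun t _ => stepFactor_outside f p q t]
  rw [mul_comm, mul_assoc]

theorem map_stepProd {N : Type*} [CommMonoid N] (φ : M →* N) (p : DyckWord) :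
    φ (stepProd f p) = stepProd (fun u d i => φ (f u d i)) p := by
  simp only [stepProd, stepFactor, map_prod, apply_ite φ, map_one]

end StepProd

theorem eq_zero_of_semilength_eq_zero {p : DyckWord} (hp : p.semilength = 0) : p = 0 := by
  by_contra h
  exact absurd (DyckWord.semilength_insidePart_lt h) (by omega)

@[elab_as_elim]
theorem dyckWord_induction {P : DyckWord → Prop} (zero : P 0)
    (nest_add : ∀ p q, P p → P q → P (p.nest + q)) (p : DyckWord) : P p := by
  induction hn : p.semilength using Nat.strong_induction_on generalizing p with
  | _ n ih =>
    by_cases h : p = 0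
    · exact h ▸ zero
    · rw [← DyckWord.nest_insidePart_add_outsidePart h]
      exact nest_add _ _ (ih _ (hn ▸ DyckWord.semilength_insidePart_lt h) _ rfl)
        (ih _ (hn ▸ DyckWord.semilength_outsidePart_lt h) _ rfl)

theorem sum_dyckPath_zero {M : Type*} [AddCommMonoid M] (g : DyckWord → M) :
    ∑ D : DyckPath 0, g D.1 = g 0 := by
  have hunique : ∀ D : DyckPath 0, D = ⟨0, rfl⟩ := fun D =>
    Subtype.ext (eq_zero_of_semilength_eq_zero D.2)
  rw [Fintype.sum_eq_single ⟨0, rfl⟩ fun D hD => absurd (hunique D) hD]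

theorem sum_dyckPath_succ {M : Type*} [AddCommMonoid M] (g : DyckWord → M) (n : ℕ) :
    ∑ D : DyckPath (n + 1), g D.1 = ∑ ab ∈ antidiagonal n,
      ∑ p : DyckPath ab.1, ∑ q : DyckPath ab.2, g (p.1.nest + q.1) := by
  simp_rw [← Fintype.sum_prod_type', Finset.sum_sigma']
  have hsemilength : ∀ x ∈ (antidiagonal n).sigma fun ab : ℕ × ℕ =>
      (Finset.univ : Finset (DyckPath ab.1 × DyckPath ab.2)),
      (x.2.1.1.nest + x.2.2.1).semilength = n + 1 := fun x hx => by
    rw [semilength_nest_add, x.2.1.2, x.2.2.2,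
      mem_antidiagonal.1 (Finset.mem_sigma.1 hx).1]
  symm
  refine Finset.sum_bij (fun x hx => ⟨x.2.1.1.nest + x.2.2.1, hsemilength x hx⟩)
    (fun _ _ => Finset.mem_univ _) ?_ ?_ fun _ _ => rfl
  · rintro ⟨⟨a, b⟩, ⟨p, hp⟩, ⟨q, hq⟩⟩ _ ⟨⟨a', b'⟩, ⟨p', hp'⟩, ⟨q', hq'⟩⟩ _ h
    have heq : p.nest + q = p'.nest + q' := congrArg Subtype.val h
    obtain rfl : p = p' := by simpa using congrArg DyckWord.insidePart heq
    obtain rfl : q = q' := by simpa using congrArg DyckWord.outsidePart heq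
    obtain ⟨rfl, rfl⟩ : a = a' ∧ b = b' := ⟨hp.symm.trans hp', hq.symm.trans hq'⟩
    rfl
  · intro D _
    have hD : D.1 ≠ 0 := fun h => by simpa [h] using D.2
    have hparts := DyckWord.nest_insidePart_add_outsidePart hD
    have hlen := congrArg DyckWord.semilength hparts
    rw [semilength_nest_add, D.2] at hlen
    exact ⟨⟨(_, _), ⟨D.1.insidePart, rfl⟩, ⟨D.1.outsidePart, rfl⟩⟩,
      Finset.mem_sigma.2 ⟨mem_antidiagonal.2 (Nat.succ_injective hlen), Finset.mem_univ _⟩,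
      Subtype.ext hparts⟩

theorem stepProd_cartanInv_self (p : DyckWord) :
    stepProd (fun _ d i => cartanInv d i i) p = 1 / ((p.semilength : ℝ) + 1) := by
  induction p using dyckWord_induction with
  | zero => simp [stepProd_zero]
  | nest_add p q hp hq =>
    have hdenom : (p.semilength : ℝ) + q.semilength + 1 + 1 ≠ 0 := by positivity
    rw [stepProd_nest_add, hp, hq, semilength_nest_add, cartanInv, min_self]
    push_cast
    field_simp
    ring

theorem DyckPath.cartanProd_eq {n : ℕ} (D : DyckPath n) : D.cartanProd = 1 / ((n : ℝ) + 1) := by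
  rw [DyckPath.cartanProd, D.prod_northSteps fun _ d i => cartanInv d i i, stepProd_cartanInv_self,
    D.2]

/-- The sum of `Γ_D` over all `n`-Dyck paths. -/
def gammaSum (n : ℕ) : MvPolynomial ℕ ℝ := ∑ D : DyckPath n, D.gammaPoly

theorem gammaSum_eq_sum_stepProd (n : ℕ) :
    gammaSum n = ∑ D : DyckPath n, stepProd (fun u d i => shift u (gammaForm d i)) D.1 :=
  Finset.sum_congr rfl fun D _ => D.prod_northSteps fun u d i => shift u (gammaForm d i)

theorem shift_zero (p : MvPolynomial ℕ ℝ) : shift 0 p = p :=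
  MvPolynomial.rename_id_apply p

theorem shift_shift (u v : ℕ) (p : MvPolynomial ℕ ℝ) : shift u (shift v p) = shift (v + u) p := by
  simp only [shift, MvPolynomial.rename_rename, Function.comp_def, add_assoc]

theorem shift_gammaSum (u n : ℕ) :
    shift u (gammaSum n) =
      ∑ D : DyckPath n, stepProd (fun v d i => shift (v + u) (gammaForm d i)) D.1 := by
  rw [gammaSum_eq_sum_stepProd, shift, map_sum]
  refine Finset.sum_congr rfl fun D _ => ?_
  simp only [← shift_shift]
  exact map_stepProd _ (MvPolynomial.rename (R := ℝ) fun j => j + u : _ →ₐ[ℝ] _).toMonoidHom D.1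

theorem gammaSum_zero : gammaSum 0 = 1 := by
  rw [gammaSum_eq_sum_stepProd, sum_dyckPath_zero, stepProd_zero]

theorem gammaSum_succ (n : ℕ) :
    gammaSum (n + 1) = ∑ ab ∈ antidiagonal n,
      gammaForm (n + 1) (ab.1 + 1) * gammaSum ab.1 * shift (ab.1 + 1) (gammaSum ab.2) := by
  rw [gammaSum_eq_sum_stepProd, sum_dyckPath_succ]
  refine Finset.sum_congr rfl fun ab hab => ?_
  rw [shift_gammaSum, gammaSum_eq_sum_stepProd, mul_assoc, Finset.sum_mul_sum, Finset.mul_sum]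
  refine Finset.sum_congr rfl fun p _ => ?_
  rw [Finset.mul_sum]
  refine Finset.sum_congr rfl fun q _ => ?_
  rw [stepProd_nest_add, p.2, q.2, mem_antidiagonal.1 hab, shift_zero, mul_assoc]

section Merge

variable {α : Type*}

/-- The increasing enumeration of the natural numbers different from `j`. -/
def skip (j k : ℕ) : ℕ := if k < j then k else k + 1

/-- The sequence `l` with the two entries `l j` and `l (j + 1)` replaced by the single entry `s`. -/
def mergeAt (j : ℕ) (l : ℕ → α) (s : α) (k : ℕ) : α :=
  if k < j then l k else if k = j then s else l (k + 1)

theorem skip_of_lt {j k : ℕ} (h : k < j) : skip j k = k := if_pos h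

theorem skip_of_le {j k : ℕ} (h : j ≤ k) : skip j k = k + 1 := if_neg h.not_gt

theorem skip_injective (j : ℕ) : Function.Injective (skip j) := by
  intro a b h
  unfold skip at h
  split_ifs at h <;> omega

theorem skip_ne (j k : ℕ) : skip j k ≠ j := by
  unfold skip
  split_ifs <;> omega

theorem skip_succ_of_ne {j k : ℕ} (h : k ≠ j) : skip (j + 1) k = skip j k := by
  unfold skip
  split_ifs <;> omega

theorem skip_succ_skip {i j : ℕ} (h : i ≤ j) (k : ℕ) :
    skip (j + 1) (skip i k) = skip i (skip j k) := by
  unfold skip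
  split_ifs <;> omega

theorem mergeAt_left (j : ℕ) (l : ℕ → α) : mergeAt j l (l j) = l ∘ skip (j + 1) := by
  ext k
  simp only [mergeAt, skip, Function.comp]
  split_ifs <;> first | rfl | omega | (congr 1; omega)

theorem mergeAt_right (j : ℕ) (l : ℕ → α) : mergeAt j l (l (j + 1)) = l ∘ skip j := by
  ext k
  simp only [mergeAt, skip, Function.comp]
  split_ifs <;> first | rfl | omega | (congr 1; omega)

end Merge

section CommRing

open MvPolynomial

/-! ### Derivations of polynomial rings -/

variable {σ R : Type*} [CommRing R]

theorem pderiv_comm (i j : σ) (p : MvPolynomial σ R) :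
    pderiv i (pderiv j p) = pderiv j (pderiv i p) := by
  classical
  have hbracket : ⁅(pderiv i : Derivation R (MvPolynomial σ R) (MvPolynomial σ R)),
      (pderiv j : Derivation R (MvPolynomial σ R) (MvPolynomial σ R))⁆ = 0 :=
    derivation_ext fun k => by
      rw [Derivation.commutator_apply, pderiv_X, pderiv_X, Pi.single_apply, Pi.single_apply]
      split_ifs <;> simp
  exact sub_eq_zero.1 <| (Derivation.commutator_apply _).symm.trans (DFunLike.congr_fun hbracket p)

theorem mkDerivation_eq_sum_pderiv {p : MvPolynomial σ R} {s : Finset σ} (hp : p.vars ⊆ s)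
    (f : σ → MvPolynomial σ R) : mkDerivation R f p = ∑ k ∈ s, f k * pderiv k p := by
  classical
  have hsum : ∀ q, (∑ k ∈ s, f k • (pderiv k : Derivation R (MvPolynomial σ R) _)) q =
      ∑ k ∈ s, f k * pderiv k q := fun q => by
    rw [← Derivation.coeFnAddMonoidHom_apply, map_sum, Finset.sum_apply]
    rfl
  rw [← hsum]
  refine derivation_eq_of_forall_mem_vars fun i hi => ?_
  simp only [mkDerivation_X, hsum, pderiv_X, Pi.single_apply, mul_ite, mul_one, mul_zero,
    Finset.sum_ite_eq, if_pos (hp hi)]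

/-- The derivation `∑ i, (a X_i + b) ∂_i`, the infinitesimal generator of a one-parameter group of
simultaneous affine substitutions: `a = 1, b = 0` is the Euler derivation and `a = 0, b = 1` the
derivative in the direction of the diagonal. -/
def affineDeriv (a b : R) : Derivation R (MvPolynomial σ R) (MvPolynomial σ R) :=
  mkDerivation R fun i => C a * X i + C b

theorem affineDeriv_X (a b : R) (i : σ) : affineDeriv a b (X i) = C a * X i + C b :=
  mkDerivation_X _ _ _

theorem affineDeriv_rename {τ : Type*} (a b : R) (f : σ → τ) (p : MvPolynomial σ R) :
    affineDeriv a b (rename f p) = rename f (affineDeriv a b p) := by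
  induction p using MvPolynomial.induction_on with
  | C r => simp only [rename_C, derivation_C, map_zero]
  | add p q hp hq => simp only [map_add, hp, hq]
  | mul_X p i hp =>
    simp only [map_mul, rename_X, Derivation.leibniz, hp, smul_eq_mul, map_add, affineDeriv_X,
      rename_C]

theorem pderiv_affineDeriv (a b : R) (j : σ) (p : MvPolynomial σ R) :
    pderiv j (affineDeriv a b p) = affineDeriv a b (pderiv j p) + a • pderiv j p := by
  classical
  have hbracket : ⁅(pderiv j : Derivation R (MvPolynomial σ R) (MvPolynomial σ R)),
      affineDeriv a b⁆ = a • pderiv j := derivation_ext fun k => by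
    simp only [Derivation.commutator_apply, affineDeriv_X, Derivation.smul_apply, map_add,
      pderiv_C_mul, pderiv_C, pderiv_X, Pi.single_apply]
    split_ifs <;> simp [smul_eq_C_mul]
  exact sub_eq_iff_eq_add'.1 <|
    (Derivation.commutator_apply _).symm.trans (DFunLike.congr_fun hbracket p)

/-- The derivative in the direction of the simple root `ε_k - ε_{k+1}`. -/
def rootDeriv (k : ℕ) : Derivation R (MvPolynomial ℕ R) (MvPolynomial ℕ R) :=
  pderiv k - pderiv (k + 1)

theorem rootDeriv_apply (k : ℕ) (p : MvPolynomial ℕ R) :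
    rootDeriv k p = pderiv k p - pderiv (k + 1) p :=
  Derivation.sub_apply _

theorem pderiv_rename_of_notMem_range {τ : Type*} {f : σ → τ} {j : τ} (h : j ∉ Set.range f)
    (p : MvPolynomial σ R) : pderiv j (rename f p) = 0 := by
  classical
  refine pderiv_eq_zero_of_notMem_vars fun hj => h ?_
  obtain ⟨i, -, hi⟩ := Finset.mem_image.1 (vars_rename _ _ hj)
  exact ⟨i, hi⟩

theorem pderiv_rename_skip_self (j : ℕ) (p : MvPolynomial ℕ R) :
    pderiv j (rename (skip j) p) = 0 :=
  pderiv_rename_of_notMem_range (fun ⟨k, hk⟩ => skip_ne j k hk) p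

theorem pderiv_rename_skip_of_lt {j k : ℕ} (h : k < j) (p : MvPolynomial ℕ R) :
    pderiv k (rename (skip j) p) = rename (skip j) (pderiv k p) := by
  rw [← pderiv_rename (skip_injective j), skip_of_lt h]

theorem pderiv_succ_rename_skip_of_le {j k : ℕ} (h : j ≤ k) (p : MvPolynomial ℕ R) :
    pderiv (k + 1) (rename (skip j) p) = rename (skip j) (pderiv k p) := by
  rw [← pderiv_rename (skip_injective j), skip_of_le h]

theorem pderiv_rename_add_of_lt {j k : ℕ} (h : j < k) (p : MvPolynomial ℕ R) :
    pderiv j (rename (· + k) p) = 0 :=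
  pderiv_rename_of_notMem_range (fun ⟨i, hi⟩ => by dsimp only at hi; omega) p

theorem pderiv_rename_add (i k : ℕ) (p : MvPolynomial ℕ R) :
    pderiv (i + k) (rename (· + k) p) = rename (· + k) (pderiv i p) :=
  pderiv_rename (add_left_injective k) i p

theorem rename_skip_rename_add_of_le {j k : ℕ} (h : j ≤ k) (p : MvPolynomial ℕ R) :
    rename (skip j) (rename (· + k) p) = rename (· + (k + 1)) p := by
  have hcomp : skip j ∘ (· + k) = (· + (k + 1)) :=
    funext fun i => skip_of_le (h.trans (Nat.le_add_left k i))
  rw [rename_rename, hcomp]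

theorem rename_skip_add_rename_add (i k : ℕ) (p : MvPolynomial ℕ R) :
    rename (skip (i + k)) (rename (· + k) p) = rename (· + k) (rename (skip i) p) := by
  have hcomp : skip (i + k) ∘ (· + k) = (· + k) ∘ skip i := by
    ext m
    simp only [Function.comp, skip]
    split_ifs <;> omega
  rw [rename_rename, rename_rename, hcomp]

theorem rename_skip_succ_rename_skip {i j : ℕ} (h : i ≤ j) (p : MvPolynomial ℕ R) :
    rename (skip (j + 1)) (rename (skip i) p) = rename (skip i) (rename (skip j) p) := by
  rw [rename_rename, rename_rename]
  exact congrArg (rename · p) (funext (skip_succ_skip h))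

end CommRing

section Antiderivative

open MvPolynomial

variable {σ K : Type*} [Field K]

/-- The antiderivative with respect to `X j` whose monomials are all divisible by `X j`. -/
def antideriv (j : σ) : MvPolynomial σ K →ₗ[K] MvPolynomial σ K :=
  (basisMonomials σ K).constr K fun m => monomial (m + Finsupp.single j 1) ((m j + 1 : K)⁻¹)

theorem antideriv_monomial (j : σ) (m : σ →₀ ℕ) (a : K) :
    antideriv j (monomial m a) = monomial (m + Finsupp.single j 1) (a / (m j + 1)) := by
  have hbasis : antideriv j (monomial m (1 : K)) =
      monomial (m + Finsupp.single j 1) ((m j + 1 : K)⁻¹) :=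
    (basisMonomials σ K).constr_basis K _ m
  rw [← mul_one a, ← smul_eq_mul, ← smul_monomial, map_smul, hbasis, smul_monomial, smul_eq_mul,
    smul_eq_mul, mul_one, div_eq_mul_inv]

/-- The polynomial whose value at `l` is the integral of `p (mergeAt j l s)` over
`l (j + 1) ≤ s ≤ l j`, see `eval_gapIntegral`. -/
def gapIntegral (j : ℕ) : MvPolynomial ℕ K →ₗ[K] MvPolynomial ℕ K :=
  ((rename (skip (j + 1))).toLinearMap - (rename (skip j)).toLinearMap) ∘ₗ antideriv j

theorem gapIntegral_apply (j : ℕ) (p : MvPolynomial ℕ K) :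
    gapIntegral j p = rename (skip (j + 1)) (antideriv j p) - rename (skip j) (antideriv j p) :=
  rfl

variable [CharZero K]

theorem pderiv_antideriv (j : σ) (p : MvPolynomial σ K) : pderiv j (antideriv j p) = p := by
  classical
  induction p using MvPolynomial.induction_on' with
  | monomial m a =>
    have hm : (m j : K) + 1 ≠ 0 := Nat.cast_add_one_ne_zero _
    simp [antideriv_monomial, pderiv_monomial, hm]
  | add p q hp hq => simp only [map_add, hp, hq]

theorem gapIntegral_pderiv (j : ℕ) (P : MvPolynomial ℕ K) :
    gapIntegral j (pderiv j P) = rename (skip (j + 1)) P - rename (skip j) P := by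
  induction P using MvPolynomial.induction_on' with
  | monomial m a =>
    rw [pderiv_monomial]
    rcases eq_or_ne (m j) 0 with hm | hm
    · have hmap : m.mapDomain (skip (j + 1)) = m.mapDomain (skip j) :=
        Finsupp.mapDomain_congr fun k hk => skip_succ_of_ne fun h =>
          Finsupp.mem_support_iff.1 hk (h ▸ hm)
      rw [hm, Nat.cast_zero, mul_zero, monomial_zero, map_zero, rename_monomial, rename_monomial,
        hmap, sub_self]
    · have hle : Finsupp.single j 1 ≤ m := Finsupp.single_le_iff.2 (Nat.one_le_iff_ne_zero.2 hm)
      have hcast : ((m - Finsupp.single j 1 : ℕ →₀ ℕ) j : K) + 1 = m j := by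
        rw [Finsupp.tsub_apply, Finsupp.single_eq_same, ← Nat.cast_succ,
          Nat.succ_eq_add_one, Nat.sub_add_cancel (Nat.one_le_iff_ne_zero.2 hm)]
      rw [gapIntegral_apply, antideriv_monomial, tsub_add_cancel_of_le hle, hcast,
        mul_div_cancel_right₀ _ (Nat.cast_ne_zero.2 hm)]
  | add p q hp hq =>
    simp only [map_add, hp, hq]
    ring

theorem pderiv_gapIntegral_of_lt {j k : ℕ} (h : k < j) (p : MvPolynomial ℕ K) :
    pderiv k (gapIntegral j p) = gapIntegral j (pderiv k p) := by
  conv_rhs => rw [← pderiv_antideriv j p, pderiv_comm, gapIntegral_pderiv]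
  rw [gapIntegral_apply, map_sub, pderiv_rename_skip_of_lt h,
    pderiv_rename_skip_of_lt (Nat.lt_succ_of_lt h)]

theorem pderiv_succ_gapIntegral_of_lt {j k : ℕ} (h : j < k) (p : MvPolynomial ℕ K) :
    pderiv (k + 1) (gapIntegral j p) = gapIntegral j (pderiv k p) := by
  conv_rhs => rw [← pderiv_antideriv j p, pderiv_comm, gapIntegral_pderiv]
  rw [gapIntegral_apply, map_sub, pderiv_succ_rename_skip_of_le h,
    pderiv_succ_rename_skip_of_le h.le]

theorem pderiv_gapIntegral_self (j : ℕ) (p : MvPolynomial ℕ K) :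
    pderiv j (gapIntegral j p) = rename (skip (j + 1)) p := by
  rw [gapIntegral_apply, map_sub, pderiv_rename_skip_of_lt j.lt_succ_self, pderiv_rename_skip_self,
    sub_zero, pderiv_antideriv]

theorem pderiv_succ_gapIntegral_self (j : ℕ) (p : MvPolynomial ℕ K) :
    pderiv (j + 1) (gapIntegral j p) = -rename (skip j) p := by
  rw [gapIntegral_apply, map_sub, pderiv_succ_rename_skip_of_le le_rfl, pderiv_rename_skip_self,
    zero_sub, pderiv_antideriv]

theorem rootDeriv_gapIntegral_self (k : ℕ) (p : MvPolynomial ℕ K) :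
    rootDeriv k (gapIntegral k p) = rename (skip (k + 1)) p + rename (skip k) p := by
  rw [rootDeriv_apply, pderiv_gapIntegral_self, pderiv_succ_gapIntegral_self, sub_neg_eq_add]

theorem sum_rootDeriv_gapIntegral_left (k : ℕ) (p : MvPolynomial ℕ K) :
    ∑ j ∈ Finset.range (k + 1), rootDeriv (k + 1) (gapIntegral j p) =
      ∑ j ∈ Finset.range (k + 1), gapIntegral j (rootDeriv k p) - rename (skip (k + 1)) p := by
  have hlt : ∀ j ∈ Finset.range k,
      rootDeriv (k + 1) (gapIntegral j p) = gapIntegral j (rootDeriv k p) := fun j hj => by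
    have hj := Finset.mem_range.1 hj
    rw [rootDeriv_apply, pderiv_succ_gapIntegral_of_lt hj,
      pderiv_succ_gapIntegral_of_lt (Nat.lt_succ_of_lt hj), rootDeriv_apply, map_sub]
  have hself : rootDeriv (k + 1) (gapIntegral k p) =
      gapIntegral k (rootDeriv k p) - rename (skip (k + 1)) p := by
    rw [rootDeriv_apply, pderiv_succ_gapIntegral_self,
      pderiv_succ_gapIntegral_of_lt k.lt_succ_self, rootDeriv_apply, map_sub, gapIntegral_pderiv]
    ring
  rw [Finset.sum_range_succ, Finset.sum_range_succ, Finset.sum_congr rfl hlt, hself, add_sub_assoc]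

theorem sum_rootDeriv_gapIntegral_right (k b : ℕ) (p : MvPolynomial ℕ K) :
    ∑ i ∈ Finset.range (b + 1), rootDeriv k (gapIntegral (i + (k + 1)) p) =
      ∑ i ∈ Finset.range (b + 1), gapIntegral (i + (k + 1)) (rootDeriv k p) -
        rename (skip (k + 1)) p := by
  have hgt : ∀ i ∈ Finset.range b, rootDeriv k (gapIntegral (i + 1 + (k + 1)) p) =
      gapIntegral (i + 1 + (k + 1)) (rootDeriv k p) := fun i _ => by
    rw [rootDeriv_apply, pderiv_gapIntegral_of_lt (by omega), pderiv_gapIntegral_of_lt (by omega),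
      rootDeriv_apply, map_sub]
  have hzero : rootDeriv k (gapIntegral (0 + (k + 1)) p) =
      gapIntegral (0 + (k + 1)) (rootDeriv k p) - rename (skip (k + 1)) p := by
    rw [zero_add, rootDeriv_apply, pderiv_gapIntegral_self,
      pderiv_gapIntegral_of_lt k.lt_succ_self, rootDeriv_apply, map_sub, gapIntegral_pderiv]
    ring
  rw [Finset.sum_range_succ', Finset.sum_range_succ', Finset.sum_congr rfl hgt, hzero,
    add_sub_assoc]

theorem gapIntegral_mul_rename_add {j k : ℕ} (h : j < k) (p q : MvPolynomial ℕ K) :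
    gapIntegral j (p * rename (· + k) q) = gapIntegral j p * rename (· + (k + 1)) q := by
  have hderiv : p * rename (· + k) q = pderiv j (antideriv j p * rename (· + k) q) := by
    rw [Derivation.leibniz, pderiv_rename_add_of_lt h, pderiv_antideriv, smul_zero, zero_add,
      smul_eq_mul, mul_comm]
  rw [hderiv, gapIntegral_pderiv, map_mul, map_mul, rename_skip_rename_add_of_le h,
    rename_skip_rename_add_of_le h.le, gapIntegral_apply, sub_mul]

theorem gapIntegral_add_mul_rename_add {k : ℕ} {p : MvPolynomial ℕ K}
    (hp : ∀ m, k ≤ m → rename (skip m) p = p) (i : ℕ) (q : MvPolynomial ℕ K) :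
    gapIntegral (i + k) (p * rename (· + k) q) = p * rename (· + k) (gapIntegral i q) := by
  have hzero : pderiv (i + k) p = 0 := by
    rw [← hp (i + k) (Nat.le_add_left k i), pderiv_rename_skip_self]
  have hderiv : p * rename (· + k) q = pderiv (i + k) (p * rename (· + k) (antideriv i q)) := by
    rw [Derivation.leibniz, hzero, pderiv_rename_add, pderiv_antideriv, smul_zero, add_zero,
      smul_eq_mul]
  rw [hderiv, gapIntegral_pderiv, map_mul, map_mul, hp _ (by omega), hp _ (by omega),
    add_right_comm, rename_skip_add_rename_add, rename_skip_add_rename_add, ← mul_sub,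
    gapIntegral_apply, map_sub]

theorem rename_skip_gapIntegral {j m : ℕ} (h : j < m) (p : MvPolynomial ℕ K) :
    rename (skip (m + 1)) (gapIntegral j p) = gapIntegral j (rename (skip m) p) := by
  conv_rhs => rw [← pderiv_antideriv j p, ← pderiv_rename_skip_of_lt h, gapIntegral_pderiv]
  rw [gapIntegral_apply, map_sub, rename_skip_succ_rename_skip h, rename_skip_succ_rename_skip h.le]

theorem affineDeriv_gapIntegral (a b : K) (j : ℕ) (p : MvPolynomial ℕ K) :
    affineDeriv a b (gapIntegral j p) = gapIntegral j (affineDeriv a b p + a • p) := by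
  conv_rhs => rw [← pderiv_antideriv j p, ← pderiv_affineDeriv, gapIntegral_pderiv]
  rw [gapIntegral_apply, map_sub, affineDeriv_rename, affineDeriv_rename]

end Antiderivative

section Interlacing

open MvPolynomial

/-! ### Iterated integration over interlacing sequences -/

variable {K : Type*} [Field K]

/-- The polynomials defined by `q_0 = 1` and
`q_{n+1}(l) = ∑_{j ≤ n} ∫ q_n(l_0, …, l_{j-1}, s, l_{j+2}, …) ds` over `l_{j+1} ≤ s ≤ l_j`. -/
def interlacePoly (K : Type*) [Field K] : ℕ → MvPolynomial ℕ K
  | 0 => 1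
  | n + 1 => ∑ j ∈ Finset.range (n + 1), gapIntegral j (interlacePoly K n)

theorem interlacePoly_zero : interlacePoly K 0 = 1 := rfl

theorem interlacePoly_succ (n : ℕ) :
    interlacePoly K (n + 1) = ∑ j ∈ Finset.range (n + 1), gapIntegral j (interlacePoly K n) := rfl

variable [CharZero K]

theorem rename_skip_interlacePoly {n m : ℕ} (h : n < m) :
    rename (skip m) (interlacePoly K n) = interlacePoly K n := by
  induction n generalizing m with
  | zero => rw [interlacePoly_zero, map_one]
  | succ n ih =>
    obtain ⟨m, rfl⟩ : ∃ m', m = m' + 1 := ⟨m - 1, by omega⟩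
    rw [interlacePoly_succ, map_sum]
    refine Finset.sum_congr rfl fun j hj => ?_
    have hj := Finset.mem_range.1 hj
    rw [rename_skip_gapIntegral (by omega), ih (Nat.lt_of_succ_lt_succ h)]

theorem vars_interlacePoly (n : ℕ) : (interlacePoly K n).vars ⊆ Finset.range (n + 1) := by
  intro k hk
  by_contra hkn
  rw [← rename_skip_interlacePoly (by simpa using hkn : n < k)] at hk
  obtain ⟨i, -, hi⟩ := Finset.mem_image.1 (vars_rename _ _ hk)
  exact skip_ne k i hi

theorem affineDeriv_interlacePoly (a b : K) (n : ℕ) :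
    affineDeriv a b (interlacePoly K n) = (n * a) • interlacePoly K n := by
  induction n with
  | zero => rw [interlacePoly_zero, Derivation.map_one_eq_zero, Nat.cast_zero, zero_mul, zero_smul]
  | succ n ih =>
    simp only [interlacePoly_succ, map_sum, affineDeriv_gapIntegral, ih, ← add_smul, map_smul,
      Finset.smul_sum, Nat.cast_succ, add_mul, one_mul]

theorem sum_gapIntegral_interlacePoly_mul (k : ℕ) (r : MvPolynomial ℕ K) :
    ∑ j ∈ Finset.range (k + 1), gapIntegral j (interlacePoly K k * rename (· + (k + 1)) r) =
      interlacePoly K (k + 1) * rename (· + (k + 1 + 1)) r := by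
  rw [interlacePoly_succ, Finset.sum_mul]
  exact Finset.sum_congr rfl fun j hj => gapIntegral_mul_rename_add (Finset.mem_range.1 hj) _ _

theorem sum_gapIntegral_mul_interlacePoly (k b : ℕ) :
    ∑ i ∈ Finset.range (b + 1), gapIntegral (i + (k + 1))
        (interlacePoly K k * rename (· + (k + 1)) (interlacePoly K b)) =
      interlacePoly K k * rename (· + (k + 1)) (interlacePoly K (b + 1)) := by
  rw [interlacePoly_succ, map_sum, Finset.mul_sum]
  exact Finset.sum_congr rfl fun i _ =>
    gapIntegral_add_mul_rename_add (fun _ => rename_skip_interlacePoly) i _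

theorem rootDeriv_interlacePoly_succ (k b : ℕ) :
    rootDeriv k (interlacePoly K (k + b + 1)) =
      (∑ j ∈ Finset.range k, rootDeriv k (gapIntegral j (interlacePoly K (k + b))) +
          rename (skip k) (interlacePoly K (k + b))) +
        (∑ i ∈ Finset.range b, rootDeriv k (gapIntegral (i + (k + 1)) (interlacePoly K (k + b))) +
          rename (skip (k + 1)) (interlacePoly K (k + b))) := by
  rw [interlacePoly_succ, map_sum, add_assoc k b 1, Finset.sum_range_add, Finset.sum_range_succ',
    add_zero, rootDeriv_gapIntegral_self]
  simp only [add_left_comm k]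
  abel

/-- The two halves of the sum in `rootDeriv_interlacePoly_succ` contribute the two binomial
coefficients of Pascal's rule. -/
theorem rootDeriv_interlacePoly (k b : ℕ) :
    rootDeriv k (interlacePoly K (k + b + 1)) = ((k + b + 2).choose (k + 1) : K) •
      (interlacePoly K k * rename (· + (k + 1)) (interlacePoly K b)) := by
  have hleft : ∑ j ∈ Finset.range k, rootDeriv k (gapIntegral j (interlacePoly K (k + b))) +
        rename (skip k) (interlacePoly K (k + b)) = ((k + b + 1).choose k : K) •
          (interlacePoly K k * rename (· + (k + 1)) (interlacePoly K b)) := by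
    cases k with
    | zero =>
      have hskip : skip 0 = (· + 1) := funext fun i => skip_of_le i.zero_le
      simp only [Finset.range_zero, Finset.sum_empty, zero_add, hskip, Nat.choose_zero_right,
        Nat.cast_one, one_smul, interlacePoly_zero, one_mul]
    | succ k =>
      rw [sum_rootDeriv_gapIntegral_left, sub_add_cancel, add_right_comm k 1 b,
        rootDeriv_interlacePoly k b]
      simp only [map_smul, ← Finset.smul_sum, sum_gapIntegral_interlacePoly_mul]
  have hright : ∑ i ∈ Finset.range b,
          rootDeriv k (gapIntegral (i + (k + 1)) (interlacePoly K (k + b))) +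
        rename (skip (k + 1)) (interlacePoly K (k + b)) = ((k + b + 1).choose (k + 1) : K) •
          (interlacePoly K k * rename (· + (k + 1)) (interlacePoly K b)) := by
    cases b with
    | zero =>
      simp only [Finset.range_zero, Finset.sum_empty, zero_add, add_zero, Nat.choose_self,
        Nat.cast_one, one_smul, interlacePoly_zero, map_one, mul_one,
        rename_skip_interlacePoly k.lt_succ_self]
    | succ b =>
      rw [sum_rootDeriv_gapIntegral_right, sub_add_cancel, ← add_assoc k b 1,
        rootDeriv_interlacePoly k b]
      simp only [map_smul, ← Finset.smul_sum, sum_gapIntegral_mul_interlacePoly]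
  rw [rootDeriv_interlacePoly_succ, hleft, hright, ← add_smul, ← Nat.cast_add,
    ← Nat.choose_succ_succ]
termination_by k + b

end Interlacing

section Recursion

open MvPolynomial

/-! ### The recursion at the first return -/

/-- The sum `l 0 + ⋯ + l (k - 1)` of the first `k` terms of a sequence. -/
def partialSum {M : Type*} [AddCommMonoid M] (l : ℕ → M) (k : ℕ) : M := ∑ i ∈ Finset.range k, l i

theorem partialSum_succ {M : Type*} [AddCommMonoid M] (l : ℕ → M) (k : ℕ) :
    partialSum l (k + 1) = partialSum l k + l k :=
  Finset.sum_range_succ l k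

theorem sum_mul_eq_sum_partialSum_mul_sub {R : Type*} [CommRing R] {u : ℕ → R} {m : ℕ}
    (hu : partialSum u (m + 1) = 0) (d : ℕ → R) :
    ∑ k ∈ Finset.range (m + 1), u k * d k =
      ∑ i ∈ Finset.range m, partialSum u (i + 1) * (d i - d (i + 1)) := by
  have hparts := Finset.sum_range_by_parts d u (m + 1)
  rw [Nat.add_sub_cancel, show ∑ i ∈ Finset.range (m + 1), u i = 0 from hu, smul_zero, zero_sub,
    ← Finset.sum_neg_distrib] at hparts
  simpa only [smul_eq_mul, partialSum, mul_comm, ← mul_neg, neg_sub] using hparts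

/-- Euler's identity for the derivation `∑ k, (l k - a) ∂_k`, where `a` is the mean of
`l 0, …, l (n + 1)`: with this choice of `a` summation by parts produces only root derivatives. -/
theorem eval_interlacePoly_succ {K : Type*} [Field K] [CharZero K] (n : ℕ) (l : ℕ → K) :
    ((n : K) + 1) * eval l (interlacePoly K (n + 1)) =
      ∑ i ∈ Finset.range (n + 1),
        (partialSum l (i + 1) - ((i : K) + 1) / ((n : K) + 2) * partialSum l (n + 2)) *
        ((n + 2).choose (i + 1) * (eval l (interlacePoly K i) *
          eval (fun k => l (k + (i + 1))) (interlacePoly K (n - i)))) := by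
  set a := partialSum l (n + 2) / ((n : K) + 2) with ha
  have hn : (n : K) + 2 ≠ 0 := by exact_mod_cast Nat.succ_ne_zero (n + 1)
  have hpartial (k : ℕ) : partialSum (fun k => l k - a) k = partialSum l k - k * a := by
    simp [partialSum, Finset.sum_sub_distrib]
  have hzero : partialSum (fun k => l k - a) (n + 1 + 1) = 0 := by
    rw [hpartial, ha]
    push_cast
    field_simp
    ring
  have heuler := congrArg (eval l) (affineDeriv_interlacePoly (1 : K) (-a) (n + 1))
  rw [affineDeriv, mkDerivation_eq_sum_pderiv (vars_interlacePoly _)] at heuler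
  simp only [map_sum, eval_mul, eval_add, eval_X, eval_C, one_mul, mul_one, smul_eval,
    ← sub_eq_add_neg, sum_mul_eq_sum_partialSum_mul_sub hzero, Nat.cast_succ] at heuler
  rw [← heuler]
  refine Finset.sum_congr rfl fun i hi => ?_
  obtain ⟨b, rfl⟩ := Nat.exists_eq_add_of_le (Finset.mem_range_succ_iff.1 hi)
  have hroot := congrArg (eval l) (rootDeriv_interlacePoly (K := K) i b)
  rw [rootDeriv_apply, eval_sub, smul_eval, eval_mul, eval_rename] at hroot
  rw [hroot, hpartial, Nat.add_sub_cancel_left, ha, mul_div_assoc', div_mul_eq_mul_div,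
    Nat.cast_succ]
  rfl

theorem partialSum_ite_sub_eq_cartanInv (d i m : ℕ) :
    partialSum (fun k => (if k < i then 1 else 0) - (i : ℝ) / (d + 1)) m = cartanInv d i m := by
  have hfilter : (Finset.range m).filter (· < i) = Finset.range (min i m) := by
    ext k
    simp only [Finset.mem_filter, Finset.mem_range, lt_min_iff, and_comm]
  rw [partialSum, Finset.sum_sub_distrib, Finset.sum_boole, hfilter, Finset.card_range,
    Finset.sum_const, Finset.card_range, nsmul_eq_mul, cartanInv]
  ring

theorem cartanInv_add_one_right {d i : ℕ} (hi : i ≤ d + 1) : cartanInv d i (d + 1) = 0 := by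
  have hd : (d : ℝ) + 1 ≠ 0 := by positivity
  rw [cartanInv, min_eq_left hi, Nat.cast_succ, mul_div_cancel_right₀ _ hd, sub_self]

theorem sum_cartanInv_mul_sub {d i : ℕ} (hi : i ≤ d + 1) (l : ℕ → ℝ) :
    ∑ j ∈ Finset.range d, cartanInv d i (j + 1) * (l j - l (j + 1)) =
      partialSum l i - i / (d + 1) * partialSum l (d + 1) := by
  have hfilter : (Finset.range (d + 1)).filter (· < i) = Finset.range i := by
    ext k
    simp only [Finset.mem_filter, Finset.mem_range]
    omega
  have hparts := sum_mul_eq_sum_partialSum_mul_sub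
    ((partialSum_ite_sub_eq_cartanInv d i (d + 1)).trans (cartanInv_add_one_right hi)) l
  simp only [partialSum_ite_sub_eq_cartanInv] at hparts
  rw [← hparts]
  simp only [sub_mul, ite_mul, one_mul, zero_mul, Finset.sum_sub_distrib, ← Finset.mul_sum,
    ← Finset.sum_filter, hfilter, partialSum]

theorem eval_gammaForm {d i : ℕ} (hi : i ≤ d + 1) {l x : ℕ → ℝ}
    (h : ∀ k, x (k + 1) = l k - l (k + 1)) :
    eval x (gammaForm d i) =
      1 / d * (d + 1).choose i * (partialSum l i - i / (d + 1) * partialSum l (d + 1)) := by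
  have hIcc : Finset.Icc 1 d = Finset.Ico 1 (d + 1) := by
    ext k
    simp only [Finset.mem_Icc, Finset.mem_Ico, Nat.lt_succ_iff]
  rw [← sum_cartanInv_mul_sub hi, gammaForm, eval_mul, eval_C, map_sum, hIcc,
    Finset.sum_Ico_eq_sum_range, Nat.add_sub_cancel]
  simp only [eval_mul, eval_C, eval_X, add_comm 1, h]

theorem eval_interlacePoly_eq_eval_gammaSum (n : ℕ) {l x : ℕ → ℝ}
    (h : ∀ k, x (k + 1) = l k - l (k + 1)) :
    eval l (interlacePoly ℝ n) = eval x (gammaSum n) := by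
  induction n using Nat.strong_induction_on generalizing l x with
  | _ n ih =>
  cases n with
  | zero => rw [interlacePoly_zero, gammaSum_zero, map_one, map_one]
  | succ n =>
    have hn : (n : ℝ) + 1 ≠ 0 := by positivity
    refine mul_left_cancel₀ hn ?_
    rw [eval_interlacePoly_succ, gammaSum_succ, map_sum, Finset.mul_sum,
      Finset.Nat.sum_antidiagonal_eq_sum_range_succ_mk]
    refine Finset.sum_congr rfl fun i hi => ?_
    have hi := Finset.mem_range.1 hi
    have hshift : eval x (shift (i + 1) (gammaSum (n - i))) =
        eval (fun k => l (k + (i + 1))) (interlacePoly ℝ (n - i)) := by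
      rw [shift, eval_rename, ih (n - i) (by omega) (x := x ∘ (· + (i + 1)))
        fun k => by simp only [Function.comp, add_right_comm _ 1, h]]
    rw [eval_mul, eval_mul, eval_gammaForm (by omega) h, hshift, ih i (by omega) h]
    push_cast
    field_simp
    ring

end Recursion

section GapIntegral

open MvPolynomial

theorem hasDerivAt_eval_mergeAt {𝕜 : Type*} [NontriviallyNormedField 𝕜] (j : ℕ) (l : ℕ → 𝕜)
    (P : MvPolynomial ℕ 𝕜) (s : 𝕜) :
    HasDerivAt (fun s => eval (mergeAt j l s) P) (eval (mergeAt j l s) (pderiv j P)) s := by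
  induction P using MvPolynomial.induction_on with
  | C a => simpa only [eval_C, pderiv_C, map_zero] using hasDerivAt_const s a
  | add p q hp hq =>
    simp only [map_add]
    exact hp.fun_add hq
  | mul_X p i hp =>
    have hX : HasDerivAt (fun s => mergeAt j l s i) (eval (mergeAt j l s) (pderiv j (X i))) s := by
      rcases eq_or_ne i j with rfl | h
      · simpa [mergeAt] using hasDerivAt_id' s
      · rw [pderiv_X_of_ne h]
        simpa [mergeAt, h] using hasDerivAt_const s _
    simp only [eval_mul, eval_X, Derivation.leibniz, smul_eq_mul, eval_add]
    exact (hp.mul hX).congr_deriv (by ring)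

theorem continuous_eval_mergeAt {𝕜 : Type*} [NontriviallyNormedField 𝕜] (j : ℕ) (l : ℕ → 𝕜)
    (p : MvPolynomial ℕ 𝕜) : Continuous fun s => eval (mergeAt j l s) p :=
  continuous_iff_continuousAt.2 fun s => (hasDerivAt_eval_mergeAt j l p s).continuousAt

theorem eval_gapIntegral (j : ℕ) (l : ℕ → ℝ) (p : MvPolynomial ℕ ℝ) :
    eval l (gapIntegral j p) = ∫ s in l (j + 1)..l j, eval (mergeAt j l s) p := by
  have hderiv (s : ℝ) : HasDerivAt (fun s => eval (mergeAt j l s) (antideriv j p))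
      (eval (mergeAt j l s) p) s := by
    simpa only [pderiv_antideriv] using hasDerivAt_eval_mergeAt j l (antideriv j p) s
  rw [intervalIntegral.integral_eq_sub_of_hasDerivAt (fun s _ => hderiv s)
    ((continuous_eval_mergeAt j l p).intervalIntegrable _ _), mergeAt_left, mergeAt_right,
    gapIntegral_apply, eval_sub, eval_rename, eval_rename]

end GapIntegral

section Majorization

/-! ### Slicing the projected permutohedron -/

/-- The image in `ℝ^n`, under forgetting one coordinate, of the set of all vectors of `ℝ^{n+1}`
majorized by `(l 0, …, l n)`. The forgotten coordinate is determined by the coordinate sum; the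
lower bounds come from the inequalities that involve it. -/
def projPermutohedron (n : ℕ) (l : ℕ → ℝ) : Set (Fin n → ℝ) :=
  {w | ∀ S : Finset (Fin n), partialSum l (n + 1) - partialSum l (n + 1 - S.card) ≤ ∑ i ∈ S, w i ∧
    ∑ i ∈ S, w i ≤ partialSum l S.card}

theorem isClosed_projPermutohedron (n : ℕ) (l : ℕ → ℝ) : IsClosed (projPermutohedron n l) := by
  simp only [projPermutohedron, Set.ofPred_forall, Set.ofPred_and]
  exact isClosed_iInter fun S =>
    (isClosed_le (by fun_prop) (by fun_prop)).inter (isClosed_le (by fun_prop) (by fun_prop))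

theorem forall_finset_fin_succ {n : ℕ} {P : Finset (Fin (n + 1)) → Prop} :
    (∀ S, P S) ↔ ∀ S : Finset (Fin n), P (S.map (Fin.succEmb n)) ∧
      P (Finset.cons 0 (S.map (Fin.succEmb n)) (by simp)) := by
  refine ⟨fun h S => ⟨h _, h _⟩, fun h S => ?_⟩
  have hmem (i : Fin n) : i.succ ∈ S ↔
      i.succ ∈ (Finset.univ.filter fun i : Fin n => i.succ ∈ S).map (Fin.succEmb n) := by simp
  by_cases hzero : (0 : Fin (n + 1)) ∈ S
  · convert (h (Finset.univ.filter fun i : Fin n => i.succ ∈ S)).2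
    ext i
    cases i using Fin.cases with
    | zero => simp [hzero]
    | succ i => rw [hmem, Finset.mem_cons, or_iff_right (Fin.succ_ne_zero i)]
  · convert (h (Finset.univ.filter fun i : Fin n => i.succ ∈ S)).1
    ext i
    cases i using Fin.cases with
    | zero => simp [hzero]
    | succ i => exact hmem i

theorem partialSum_mergeAt_of_le {M : Type*} [AddCommMonoid M] {j k : ℕ} (h : k ≤ j) (l : ℕ → M)
    (s : M) : partialSum (mergeAt j l s) k = partialSum l k :=
  Finset.sum_congr rfl fun _ hi => if_pos ((Finset.mem_range.1 hi).trans_le h)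

theorem partialSum_mergeAt_of_lt {M : Type*} [AddCommGroup M] {j k : ℕ} (h : j < k) (l : ℕ → M)
    (t : M) :
    partialSum (mergeAt j l (l j + l (j + 1) - t)) k = partialSum l (k + 1) - t := by
  induction k, h using Nat.le_induction with
  | base =>
    rw [partialSum_succ, partialSum_mergeAt_of_le le_rfl, partialSum_succ, partialSum_succ, mergeAt,
      if_neg (lt_irrefl j), if_pos rfl]
    abel
  | succ k hk ih =>
    rw [partialSum_succ, ih, partialSum_succ l (k + 1), mergeAt, if_neg (by omega),
      if_neg (by omega), sub_add_eq_add_sub]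

theorem partialSum_mergeAt_eq_min {m j k : ℕ} {l : ℕ → ℝ} (hl : AntitoneOn l (Set.Iic m))
    (hj : j < m) (hk : k ≤ m) {t : ℝ} (ht : t ∈ Set.Icc (l (j + 1)) (l j)) :
    partialSum (mergeAt j l (l j + l (j + 1) - t)) k =
      min (partialSum l k) (partialSum l (k + 1) - t) := by
  rcases le_or_gt k j with hkj | hjk
  · rw [partialSum_mergeAt_of_le hkj, partialSum_succ, add_sub_assoc, min_eq_left]
    exact le_add_of_nonneg_right (sub_nonneg.2 (ht.2.trans (hl hk hj.le hkj)))
  · rw [partialSum_mergeAt_of_lt hjk, partialSum_succ, add_sub_assoc, min_eq_right]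
    exact add_le_of_nonpos_right (sub_nonpos.2 ((hl (Nat.succ_le_of_lt hj) hk hjk).trans ht.1))

theorem cons_mem_projPermutohedron {n j : ℕ} (hj : j ≤ n) {l : ℕ → ℝ}
    (hl : AntitoneOn l (Set.Iic (n + 1))) {t : ℝ} (ht : t ∈ Set.Icc (l (j + 1)) (l j))
    (w : Fin n → ℝ) :
    (Fin.cons t w : Fin (n + 1) → ℝ) ∈ projPermutohedron (n + 1) l ↔
      w ∈ projPermutohedron n (mergeAt j l (l j + l (j + 1) - t)) := by
  simp only [projPermutohedron, Set.mem_ofPred_eq]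
  rw [forall_finset_fin_succ]
  refine forall_congr' fun S => ?_
  have hS : S.card ≤ n := by simpa using S.card_le_univ
  simp only [Finset.sum_map, Finset.sum_cons, Finset.card_map, Finset.card_cons, Fin.coe_succEmb,
    Fin.cons_succ, Fin.cons_zero]
  rw [partialSum_mergeAt_of_lt (Nat.lt_succ_of_le hj),
    partialSum_mergeAt_eq_min hl (by omega) (by omega) ht,
    partialSum_mergeAt_eq_min hl (by omega) (by omega) ht, sub_le_comm (b := min _ _),
    le_min_iff, le_min_iff, Nat.add_sub_add_right, Nat.sub_add_comm (by omega : S.card ≤ n + 1)]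
  constructor
  · rintro ⟨⟨_, _⟩, _, _⟩
    refine ⟨⟨?_, ?_⟩, ?_, ?_⟩ <;> linarith
  · rintro ⟨⟨_, _⟩, _, _⟩
    refine ⟨⟨?_, ?_⟩, ?_, ?_⟩ <;> linarith

theorem mem_Icc_of_cons_mem_projPermutohedron {n : ℕ} {l : ℕ → ℝ} {t : ℝ} {w : Fin n → ℝ}
    (h : (Fin.cons t w : Fin (n + 1) → ℝ) ∈ projPermutohedron (n + 1) l) :
    t ∈ Set.Icc (l (n + 1)) (l 0) := by
  have hzero := h {0}
  rw [Finset.card_singleton, Finset.sum_singleton, Fin.cons_zero, Nat.add_sub_cancel,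
    partialSum_succ, add_sub_cancel_left] at hzero
  exact ⟨hzero.1, hzero.2.trans_eq (Finset.sum_range_one l)⟩

theorem antitoneOn_mergeAt {α : Type*} [Preorder α] {n j : ℕ} (hj : j ≤ n) {l : ℕ → α}
    (hl : AntitoneOn l (Set.Iic (n + 1))) {s : α} (hs : s ∈ Set.Icc (l (j + 1)) (l j)) :
    AntitoneOn (mergeAt j l s) (Set.Iic n) := by
  intro a ha b hb hab
  rw [Set.mem_Iic] at ha hb
  have hle (c d : ℕ) (hcd : c ≤ d) (hd : d ≤ n + 1) : l d ≤ l c :=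
    hl (Set.mem_Iic.2 (hcd.trans hd)) (Set.mem_Iic.2 hd) hcd
  unfold mergeAt
  split_ifs <;>
    first
    | omega
    | exact le_rfl
    | exact hle _ _ (by omega) (by omega)
    | exact hs.2.trans (hle _ _ (by omega) (by omega))
    | exact (hle (j + 1) _ (by omega) (by omega)).trans hs.1

end Majorization

section Volume

open MvPolynomial

theorem setLIntegral_Ioc_eq_sum {α : Type*} [MeasurableSpace α] [TopologicalSpace α]
    [LinearOrder α] [OrderClosedTopology α] [OpensMeasurableSpace α] (μ : Measure α) {l : ℕ → α}
    {m : ℕ} (hl : AntitoneOn l (Set.Iic m)) (g : α → ENNReal) :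
    ∫⁻ t in Set.Ioc (l m) (l 0), g t ∂μ =
      ∑ j ∈ Finset.range m, ∫⁻ t in Set.Ioc (l (j + 1)) (l j), g t ∂μ := by
  induction m with
  | zero => simp
  | succ m ih =>
    have hunion : Set.Ioc (l (m + 1)) (l 0) =
        Set.Ioc (l m) (l 0) ∪ Set.Ioc (l (m + 1)) (l m) := by
      rw [Set.union_comm, Set.Ioc_union_Ioc_eq_Ioc]
      · exact hl m.le_succ (Set.mem_Iic.2 le_rfl) m.le_succ
      · exact hl (Nat.zero_le _) m.le_succ m.zero_le
    rw [Finset.sum_range_succ, ← ih (hl.mono (Set.Iic_subset_Iic.2 m.le_succ)), hunion,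
      lintegral_union measurableSet_Ioc]
    exact Set.disjoint_left.2 fun t ht ht' => ht'.2.not_gt ht.1

theorem volume_eq_lintegral_cons {α : Type*} [MeasureSpace α] [SigmaFinite (volume : Measure α)]
    {n : ℕ} {s : Set (Fin (n + 1) → α)} (hs : MeasurableSet s) :
    volume s = ∫⁻ t, volume {w : Fin n → α | (Fin.cons t w : Fin (n + 1) → α) ∈ s} := by
  have hpres := (volume_preserving_piFinSuccAbove (fun _ : Fin (n + 1) => α) 0).symm
  rw [← hpres.measure_preimage hs.nullMeasurableSet, Measure.volume_eq_prod,
    Measure.prod_apply (hpres.measurable hs)]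
  refine lintegral_congr fun t => congrArg volume (Set.ext fun w => ?_)
  change (Fin.insertNth 0 t w : Fin (n + 1) → α) ∈ s ↔ _
  rw [Fin.insertNth_zero']
  rfl

theorem setLIntegral_eval_mergeAt {j : ℕ} {l : ℕ → ℝ} {p : MvPolynomial ℕ ℝ}
    (hl : l (j + 1) ≤ l j)
    (hp : ∀ s ∈ Set.Icc (l (j + 1)) (l j), 0 ≤ eval (mergeAt j l s) p) :
    ∫⁻ t in Set.Ioc (l (j + 1)) (l j),
        ENNReal.ofReal (eval (mergeAt j l (l j + l (j + 1) - t)) p) =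
      ENNReal.ofReal (eval l (gapIntegral j p)) := by
  have hcont : Continuous fun t => eval (mergeAt j l (l j + l (j + 1) - t)) p :=
    (continuous_eval_mergeAt j l p).comp (continuous_const.sub continuous_id)
  rw [← ofReal_integral_eq_lintegral_ofReal, ← intervalIntegral.integral_of_le hl,
    intervalIntegral.integral_comp_sub_left (fun s => eval (mergeAt j l s) p), eval_gapIntegral,
    add_sub_cancel_left, add_sub_cancel_right]
  · exact hcont.integrableOn_Icc.mono_set Set.Ioc_subset_Icc_self
  · refine (ae_restrict_iff' measurableSet_Ioc).2 (Filter.Eventually.of_forall fun t ht => ?_)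
    exact hp _ ⟨by linarith [ht.2], by linarith [ht.1]⟩

theorem eval_gapIntegral_nonneg {j : ℕ} {l : ℕ → ℝ} {p : MvPolynomial ℕ ℝ}
    (hl : l (j + 1) ≤ l j)
    (hp : ∀ s ∈ Set.Icc (l (j + 1)) (l j), 0 ≤ eval (mergeAt j l s) p) :
    0 ≤ eval l (gapIntegral j p) :=
  eval_gapIntegral j l p ▸ intervalIntegral.integral_nonneg hl hp

theorem eval_interlacePoly_nonneg {n : ℕ} {l : ℕ → ℝ} (hl : AntitoneOn l (Set.Iic n)) :
    0 ≤ eval l (interlacePoly ℝ n) := by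
  induction n generalizing l with
  | zero => simp only [interlacePoly_zero, map_one, zero_le_one]
  | succ n ih =>
    rw [interlacePoly_succ, map_sum]
    refine Finset.sum_nonneg fun j hj => ?_
    have hj := Finset.mem_range.1 hj
    exact eval_gapIntegral_nonneg (hl hj.le hj j.le_succ) fun s hs =>
      ih (antitoneOn_mergeAt (Nat.le_of_lt_succ hj) hl hs)

theorem volume_projPermutohedron {n : ℕ} {l : ℕ → ℝ} (hl : AntitoneOn l (Set.Iic n)) :
    volume (projPermutohedron n l) = ENNReal.ofReal (eval l (interlacePoly ℝ n)) := by
  induction n generalizing l with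
  | zero =>
    have huniv : projPermutohedron 0 l = Set.univ := Set.eq_univ_of_forall fun w S => by
      simp [partialSum, Finset.eq_empty_of_isEmpty S]
    simp [huniv, interlacePoly_zero, volume_pi]
  | succ n ih =>
    have hle {j : ℕ} (hj : j ≤ n) : l (j + 1) ≤ l j :=
      hl (Nat.le_succ_of_le hj) (Nat.succ_le_succ hj) j.le_succ
    have hnonneg {j : ℕ} (hj : j ≤ n) (s : ℝ) (hs : s ∈ Set.Icc (l (j + 1)) (l j)) :
        0 ≤ eval (mergeAt j l s) (interlacePoly ℝ n) :=
      eval_interlacePoly_nonneg (antitoneOn_mergeAt hj hl hs)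
    have hslice {j : ℕ} (hj : j ≤ n) (t : ℝ) (ht : t ∈ Set.Ioc (l (j + 1)) (l j)) :
        volume {w : Fin n → ℝ |
            (Fin.cons t w : Fin (n + 1) → ℝ) ∈ projPermutohedron (n + 1) l} =
          ENNReal.ofReal (eval (mergeAt j l (l j + l (j + 1) - t)) (interlacePoly ℝ n)) := by
      rw [← ih (antitoneOn_mergeAt hj hl ⟨by linarith [ht.2], by linarith [ht.1]⟩)]
      exact congrArg volume (Set.ext fun w =>
        cons_mem_projPermutohedron hj hl (Set.Ioc_subset_Icc_self ht) w)
    have hsupport : Function.support (fun t => volume {w : Fin n → ℝ |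
        (Fin.cons t w : Fin (n + 1) → ℝ) ∈ projPermutohedron (n + 1) l}) ⊆
          Set.Icc (l (n + 1)) (l 0) := fun t ht =>
      have ⟨w, hw⟩ := nonempty_of_measure_ne_zero ht
      mem_Icc_of_cons_mem_projPermutohedron hw
    rw [volume_eq_lintegral_cons (isClosed_projPermutohedron _ _).measurableSet,
      ← setLIntegral_eq_of_support_subset hsupport, setLIntegral_congr Ioc_ae_eq_Icc.symm,
      setLIntegral_Ioc_eq_sum volume hl, interlacePoly_succ, map_sum]
    have hpiece : ∀ j ∈ Finset.range (n + 1), _ := fun j hj =>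
      have hj := Finset.mem_range_succ_iff.1 hj
      (setLIntegral_congr_fun measurableSet_Ioc (hslice hj)).trans
        (setLIntegral_eval_mergeAt (hle hj) (hnonneg hj))
    rw [Finset.sum_congr rfl hpiece, ENNReal.ofReal_sum_of_nonneg]
    intro j hj
    have hj := Finset.mem_range_succ_iff.1 hj
    exact eval_gapIntegral_nonneg (hle hj) (hnonneg hj)

end Volume

section Rado

/-! ### Rado's theorem on permutohedra and majorization -/

theorem sum_le_partialSum {M : Type*} [AddCommMonoid M] [PartialOrder M] [IsOrderedAddMonoid M]
    {n : ℕ} {l : ℕ → M} (hl : AntitoneOn l (Set.Iic n)) (S : Finset (Fin (n + 1))) :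
    ∑ i ∈ S, l i ≤ partialSum l S.card := by
  induction S using Finset.induction_on_max with
  | empty => exact le_rfl
  | insert a S ha ih =>
    have haS : a ∉ S := fun h => (ha a h).false
    have hcard : S.card ≤ a :=
      (Finset.card_le_card fun i hi => Finset.mem_Iio.2 (ha i hi)).trans_eq (Fin.card_Iio a)
    have han : (a : ℕ) ≤ n := Nat.le_of_lt_succ a.2
    rw [Finset.sum_insert haS, Finset.card_insert_of_notMem haS, partialSum_succ, add_comm]
    exact add_le_add ih (hl (hcard.trans han) han hcard)

theorem sum_mul_nonneg_of_partialSum_nonneg {R : Type*} [CommRing R] [PartialOrder R]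
    [IsOrderedRing R] {m : ℕ} {u d : ℕ → R} (hd : AntitoneOn d (Set.Iic m))
    (hu : ∀ k ≤ m, 0 ≤ partialSum u k) (htotal : partialSum u (m + 1) = 0) :
    0 ≤ ∑ k ∈ Finset.range (m + 1), u k * d k := by
  rw [sum_mul_eq_sum_partialSum_mul_sub htotal]
  refine Finset.sum_nonneg fun i hi => ?_
  have hi := Finset.mem_range.1 hi
  exact mul_nonneg (hu _ hi) (sub_nonneg.2 (hd hi.le hi i.le_succ))

/-- By the rearrangement inequality the best permutation sorts `c` in decreasing order. -/
theorem exists_perm_sum_mul_le {n : ℕ} {l : ℕ → ℝ} {u : Fin (n + 1) → ℝ}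
    (hu : ∀ S : Finset (Fin (n + 1)), ∑ i ∈ S, u i ≤ partialSum l S.card)
    (htotal : ∑ i, u i = ∑ i : Fin (n + 1), l i) (c : Fin (n + 1) → ℝ) :
    ∃ σ : Equiv.Perm (Fin (n + 1)), ∑ i, c i * u i ≤ ∑ i, c i * l (σ.symm i) := by
  set σ := Tuple.sort (OrderDual.toDual ∘ c)
  have hσ : Antitone (c ∘ σ) := Tuple.monotone_sort (OrderDual.toDual ∘ c)
  let toFin : ℕ → Fin (n + 1) := Fin.ofNat (n + 1)
  have hcoe (i : Fin (n + 1)) : toFin i = i := Fin.ext (Nat.mod_eq_of_lt i.2)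
  have hantitone : AntitoneOn (c ∘ σ ∘ toFin) (Set.Iic n) := fun i _ j hj hij =>
    hσ ((Nat.mod_le _ _).trans (hij.trans (Nat.mod_eq_of_lt (Nat.lt_succ_of_le hj)).ge))
  have hpartial (k : ℕ) : partialSum (fun k => l k - u (σ (toFin k))) k =
      partialSum l k - partialSum (u ∘ σ ∘ toFin) k := Finset.sum_sub_distrib ..
  have hnonneg := sum_mul_nonneg_of_partialSum_nonneg hantitone
    (u := fun k => l k - u (σ (toFin k))) (fun k hk => ?_) ?_
  · refine ⟨σ, ?_⟩
    rw [← Equiv.sum_comp σ, ← Equiv.sum_comp σ (fun i => c i * l (σ.symm i))]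
    rw [← Fin.sum_univ_eq_sum_range (fun k => (l k - u (σ (toFin k))) * (c ∘ σ ∘ toFin) k)]
      at hnonneg
    simp only [Function.comp, hcoe, sub_mul, Finset.sum_sub_distrib] at hnonneg
    simpa only [σ.symm_apply_apply, mul_comm (c _)] using sub_nonneg.1 hnonneg
  · have hS := hu (Finset.univ.map
      ((Fin.castLEEmb (Nat.le_succ_of_le hk)).trans σ.toEmbedding))
    rw [Finset.sum_map, Finset.card_map, Finset.card_univ, Fintype.card_fin] at hS
    rw [hpartial, sub_nonneg, partialSum, ← Fin.sum_univ_eq_sum_range (u ∘ σ ∘ toFin)]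
    refine le_of_eq_of_le (Finset.sum_congr rfl fun i _ => ?_) hS
    exact congrArg (u ∘ σ) (hcoe (Fin.castLE (Nat.le_succ_of_le hk) i))
  · rw [hpartial, sub_eq_zero, partialSum, partialSum, ← Fin.sum_univ_eq_sum_range,
      ← Fin.sum_univ_eq_sum_range, ← htotal, ← Equiv.sum_comp σ u]
    simp only [Function.comp, hcoe]

theorem permute_apply {n : ℕ} (w : Equiv.Perm (Fin (n + 1))) (v : E n) (k : Fin (n + 1)) :
    (permute w v).1 k = v.1 (w.symm k) := rfl

theorem sum_coe_eq_zero {n : ℕ} (v : E n) : ∑ k, v.1 k = 0 := v.2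

theorem inner_eq_sum {n : ℕ} (u v : E n) : inner ℝ u v = ∑ k, u.1 k * v.1 k := by
  rw [Submodule.coe_inner, PiLp.inner_apply]
  exact Finset.sum_congr rfl fun k _ => mul_comm _ _

variable {n : ℕ} {l : ℕ → ℝ} {u v : E n}

theorem sum_le_partialSum_of_mem_permutohedron (hl : AntitoneOn l (Set.Iic n))
    (hv : ∀ k : Fin (n + 1), v.1 k = l k) (hu : u ∈ permutohedron v) (S : Finset (Fin (n + 1))) :
    ∑ i ∈ S, u.1 i ≤ partialSum l S.card := by
  let sumOver : E n →ₗ[ℝ] ℝ :=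
    { toFun := fun u => ∑ i ∈ S, u.1 i
      map_add' := fun x y => Finset.sum_add_distrib
      map_smul' := fun a x => (Finset.mul_sum ..).symm }
  refine convexHull_min ?_ (convex_halfSpace_le sumOver.isLinear (partialSum l S.card)) hu
  rintro _ ⟨w, rfl⟩
  have hsum := sum_le_partialSum hl (S.map w.symm.toEmbedding)
  rw [Finset.sum_map, Finset.card_map] at hsum
  exact (Finset.sum_congr rfl fun i _ => hv (w.symm i)).trans_le hsum

theorem mem_permutohedron_of_sum_le_partialSum (hv : ∀ k : Fin (n + 1), v.1 k = l k)
    (hu : ∀ S : Finset (Fin (n + 1)), ∑ i ∈ S, u.1 i ≤ partialSum l S.card) :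
    u ∈ permutohedron v := by
  by_contra hnot
  obtain ⟨f, s, hf, hs⟩ := geometric_hahn_banach_closed_point (convex_convexHull ℝ _)
    ((Set.finite_range fun w => permute w v).isClosed_convexHull ℝ) hnot
  obtain ⟨c, rfl⟩ := (InnerProductSpace.toDual ℝ (E n)).surjective f
  have htotal : ∑ i, u.1 i = ∑ i : Fin (n + 1), l i := by
    simp only [← hv, sum_coe_eq_zero]
  obtain ⟨σ, hσ⟩ := exists_perm_sum_mul_le hu htotal (fun i => c.1 i)
  refine ((hf _ (subset_convexHull ℝ _ ⟨σ, rfl⟩)).trans hs).not_ge ?_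
  simpa only [InnerProductSpace.toDual_apply_apply, inner_eq_sum, permute_apply, hv] using hσ

theorem mem_permutohedron_iff (hl : AntitoneOn l (Set.Iic n))
    (hv : ∀ k : Fin (n + 1), v.1 k = l k) :
    u ∈ permutohedron v ↔ ∀ S : Finset (Fin (n + 1)), ∑ i ∈ S, u.1 i ≤ partialSum l S.card :=
  ⟨sum_le_partialSum_of_mem_permutohedron hl hv, mem_permutohedron_of_sum_le_partialSum hv⟩

theorem coe_zero_eq_neg_sum (u : E n) : u.1 0 = -∑ i : Fin n, u.1 i.succ :=
  eq_neg_of_add_eq_zero_left ((Fin.sum_univ_succ u.1).symm.trans (sum_coe_eq_zero u))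

theorem mem_permutohedron_iff_mem_projPermutohedron (hl : AntitoneOn l (Set.Iic n))
    (hv : ∀ k : Fin (n + 1), v.1 k = l k) :
    u ∈ permutohedron v ↔ (fun i : Fin n => u.1 i.succ) ∈ projPermutohedron n l := by
  have htotal : partialSum l (n + 1) = 0 := by
    rw [partialSum, ← Fin.sum_univ_eq_sum_range]
    simp only [← hv, sum_coe_eq_zero]
  have hcompl (S : Finset (Fin n)) : u.1 0 + ∑ i ∈ S, u.1 i.succ = -∑ i ∈ Sᶜ, u.1 i.succ := by
    rw [coe_zero_eq_neg_sum, ← Finset.sum_add_sum_compl S]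
    ring
  have hcard (S : Finset (Fin n)) : n + 1 - S.card = Sᶜ.card + 1 := by
    rw [Finset.card_compl, Fintype.card_fin, Nat.sub_add_comm (by simpa using S.card_le_univ)]
  rw [mem_permutohedron_iff hl hv, forall_finset_fin_succ, forall_and]
  simp only [projPermutohedron, Set.mem_ofPred_eq, Finset.sum_map, Finset.sum_cons,
    Finset.card_map, Finset.card_cons, Fin.coe_succEmb, htotal, hcompl, hcard, forall_and, zero_sub]
  rw [and_comm]
  refine and_congr_left' (Iff.trans ?_
    (compl_surjective (α := Finset (Fin n))).forall.symm)
  simp only [compl_compl, neg_le]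

end Rado

section HaarMeasure

/-! ### Haar measures of bases -/

open Module

theorem abs_det_eq_sqrt_det_gram {ι F : Type*} [Fintype ι] [DecidableEq ι]
    [NormedAddCommGroup F] [InnerProductSpace ℝ F] (b : OrthonormalBasis ι ℝ F) (v : ι → F) :
    |b.toBasis.det v| = √(Matrix.gram ℝ v).det := by
  rw [Matrix.gram_eq_conjTranspose_mul b v, Matrix.det_mul, Matrix.det_conjTranspose, star_trivial,
    ← sq, Real.sqrt_sq_eq_abs]
  rfl

theorem orthonormalBasis_addHaar_eq_smul {ι κ F : Type*} [Fintype ι] [Fintype κ] [DecidableEq κ]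
    [NormedAddCommGroup F] [InnerProductSpace ℝ F] [MeasurableSpace F] [BorelSpace F]
    [SecondCountableTopology F] (b : OrthonormalBasis ι ℝ F) (v : Basis κ ℝ F) :
    b.toBasis.addHaar = ENNReal.ofReal √(Matrix.gram ℝ v).det • v.addHaar := by
  rw [← Basis.addHaar_reindex b.toBasis (b.toBasis.indexEquiv v),
    ← OrthonormalBasis.reindex_toBasis, v.addHaar_def,
    Measure.addHaarMeasure_unique (OrthonormalBasis.toBasis _).addHaar v.parallelepiped,
    Basis.coe_parallelepiped, Measure.addHaar_parallelepiped, abs_det_eq_sqrt_det_gram]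

theorem eq_addHaar_of_parallelepiped_eq_one {ι F : Type*} [Fintype ι] [DecidableEq ι]
    [NormedAddCommGroup F] [NormedSpace ℝ F] [MeasurableSpace F] [BorelSpace F]
    [SecondCountableTopology F] (b : Basis ι ℝ F) {v : ι → F} (hdet : |b.det v| = 1)
    (μ : Measure F) [μ.IsAddLeftInvariant] (hμ : μ (parallelepiped v) = 1) : μ = b.addHaar := by
  have hunit : IsUnit (b.det v) := isUnit_iff_ne_zero.2 (abs_ne_zero.1 (hdet ▸ one_ne_zero))
  obtain ⟨hli, hspan⟩ := (Basis.is_basis_iff_det b).2 hunit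
  let c : Basis ι ℝ F := Basis.mk hli hspan.ge
  have hc : (c.parallelepiped : Set F) = parallelepiped v := by
    rw [Basis.coe_parallelepiped, Basis.coe_mk]
  have : μ.IsAddHaarMeasure := Measure.isAddHaarMeasure_of_isCompact_nonempty_interior μ
    c.parallelepiped c.parallelepiped.isCompact c.parallelepiped.interior_nonempty
    (by rw [hc, hμ]; exact one_ne_zero) (by rw [hc, hμ]; exact ENNReal.one_ne_top)
  have : FiniteDimensional ℝ F := b.finiteDimensional_of_finite
  have hcμ : c.addHaar = μ := (c.addHaar_eq_iff μ).2 (by rw [hc, hμ])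
  have hcb : c.addHaar = b.addHaar := (c.addHaar_eq_iff _).2 (by
    rw [hc, Measure.addHaar_parallelepiped, hdet, ENNReal.ofReal_one])
  exact hcμ.symm.trans hcb

end HaarMeasure

section Hyperplane

/-! ### Volumes on the hyperplane -/

open Module MvPolynomial

/-- The coordinates on `E n` given by all entries but the first. -/
def tailEquiv (n : ℕ) : E n ≃ₗ[ℝ] (Fin n → ℝ) where
  toFun u i := u.1 i.succ
  map_add' _ _ := rfl
  map_smul' _ _ := rfl
  invFun w := ⟨WithLp.toLp 2 (Fin.cons (-∑ i, w i) w), by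
    change ∑ k, (Fin.cons (-∑ i, w i) w : Fin (n + 1) → ℝ) k = 0
    rw [Fin.sum_univ_succ, Fin.cons_zero]
    exact neg_add_cancel _⟩
  left_inv u := by
    ext k
    cases k using Fin.cases with
    | zero => exact (coe_zero_eq_neg_sum u).symm
    | succ i => rfl
  right_inv _ := rfl

/-- The basis of `E n` dual to the coordinates `tailEquiv n`; its `i`-th vector is
`ε_{i.succ} - ε_0`. -/
def tailBasis (n : ℕ) : Basis (Fin n) ℝ (E n) := Basis.ofEquivFun (tailEquiv n)

theorem tailBasis_apply_succ {n : ℕ} (i k : Fin n) :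
    (tailBasis n i).1 k.succ = if k = i then 1 else 0 := by
  rw [tailBasis, Basis.coe_ofEquivFun]
  exact Pi.single_apply i 1 k

theorem tailBasis_apply_zero {n : ℕ} (i : Fin n) : (tailBasis n i).1 0 = -1 := by
  simp only [coe_zero_eq_neg_sum, tailBasis_apply_succ, Finset.sum_ite_eq', Finset.mem_univ,
    if_true]

theorem map_tailBasis_addHaar (n : ℕ) :
    (tailBasis n).addHaar.map (tailEquiv n).toContinuousLinearEquiv = volume := by
  rw [Basis.map_addHaar, ← addHaarMeasure_eq_volume_pi, ← Basis.parallelepiped_basisFun,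
    ← Basis.addHaar_def]
  congr 1

theorem tailBasis_addHaar_permutohedron {n : ℕ} {l : ℕ → ℝ} (hl : AntitoneOn l (Set.Iic n))
    {v : E n} (hv : ∀ k : Fin (n + 1), v.1 k = l k) :
    (tailBasis n).addHaar.real (permutohedron v) = eval l (interlacePoly ℝ n) := by
  have hpreimage : permutohedron v =
      (tailEquiv n).toContinuousLinearEquiv ⁻¹' projPermutohedron n l :=
    Set.ext fun u => mem_permutohedron_iff_mem_projPermutohedron hl hv
  rw [hpreimage, measureReal_def, ← Measure.map_apply (by fun_prop)
    (isClosed_projPermutohedron n l).measurableSet, map_tailBasis_addHaar,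
    volume_projPermutohedron hl, ENNReal.toReal_ofReal (eval_interlacePoly_nonneg hl)]

theorem inner_simpleRoot {n : ℕ} (u : E n) (i : Fin n) :
    inner ℝ u (simpleRoot n i) = u.1 i.castSucc - u.1 i.succ := by
  simp only [Submodule.coe_inner, simpleRoot, inner_sub_right, EuclideanSpace.inner_single_right,
    conj_trivial, one_mul]

theorem inner_weightVector_simpleRoot {n : ℕ} (x : ℕ → ℝ) (i : Fin n) :
    inner ℝ (weightVector n x) (simpleRoot n i) = x (i + 1) := by
  have hterm (k : Fin n) : inner ℝ (x (k + 1) • fundamentalWeight n k) (simpleRoot n i) =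
      x (k + 1) * if k = i then 1 else 0 := by
    rw [← inner_fundamentalWeight_simpleRoot]
    exact real_inner_smul_left (fundamentalWeight n k) (simpleRoot n i) (x (k + 1))
  simp only [weightVector, sum_inner, hterm, mul_ite, mul_one, mul_zero, Finset.sum_ite_eq',
    Finset.mem_univ, if_true]

theorem weightVector_apply {n : ℕ} (x : ℕ → ℝ) (k : Fin (n + 1)) :
    (weightVector n x).1 k = (weightVector n x).1 0 - partialSum (fun j => x (j + 1)) k := by
  induction k using Fin.induction with
  | zero => exact (sub_zero _).symm
  | succ i ih =>
    have hdiff := (inner_simpleRoot (weightVector n x) i).symm.trans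
      (inner_weightVector_simpleRoot x i)
    rw [Fin.val_succ, partialSum_succ, ← hdiff, ih, Fin.val_castSucc]
    ring

theorem tailBasis_addHaar_permutohedron_weightVector {n : ℕ} {x : ℕ → ℝ}
    (hx : ∀ j ∈ Finset.Icc 1 n, 0 ≤ x j) :
    (tailBasis n).addHaar.real (permutohedron (weightVector n x)) = eval x (gammaSum n) := by
  let l : ℕ → ℝ := fun k => (weightVector n x).1 0 - partialSum (fun j => x (j + 1)) k
  have hstep (k : ℕ) : x (k + 1) = l k - l (k + 1) := by
    simp only [l, partialSum_succ]
    ring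
  have hl : AntitoneOn l (Set.Iic n) := by
    refine antitoneOn_of_succ_le Set.ordConnected_Iic fun k _ _ hk => ?_
    exact sub_nonneg.1 (hstep k ▸ hx _ (Finset.mem_Icc.2 ⟨k.succ_pos, hk⟩))
  rw [tailBasis_addHaar_permutohedron hl (weightVector_apply x),
    eval_interlacePoly_eq_eval_gammaSum n hstep]

theorem abs_det_tailBasis_simpleRoot (n : ℕ) : |(tailBasis n).det (simpleRoot n)| = 1 := by
  have hentry (i j : Fin n) : (tailBasis n).toMatrix (simpleRoot n) i j =
      (if i.succ = j.castSucc then 1 else 0) - (if i = j then 1 else 0) := by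
    change (simpleRoot n j).1 i.succ = _
    simp [simpleRoot]
  have hupper : ((tailBasis n).toMatrix (simpleRoot n)).IsUpperTriangular := by
    intro i j hij
    have hij : j < i := hij
    have hsucc : i.succ ≠ j.castSucc :=
      ((Fin.castSucc_lt_castSucc_iff.2 hij).trans Fin.castSucc_lt_succ).ne'
    rw [hentry, if_neg hsucc, if_neg hij.ne', sub_zero]
  have hdiag (i : Fin n) : (tailBasis n).toMatrix (simpleRoot n) i i = -1 := by
    rw [hentry, if_neg Fin.castSucc_lt_succ.ne', if_pos rfl, zero_sub]
  rw [Basis.det_apply, Matrix.det_of_isUpperTriangular hupper]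
  simp only [hdiag, Finset.prod_const, abs_neg_one_pow]

theorem det_gram_tailBasis (n : ℕ) : (Matrix.gram ℝ (tailBasis n)).det = (n : ℝ) + 1 := by
  have hgram : Matrix.gram ℝ (tailBasis n) =
      1 + Matrix.replicateCol Unit (fun _ => (1 : ℝ)) *
        Matrix.replicateRow Unit (fun _ => (1 : ℝ)) := by
    ext i j
    rw [Matrix.gram_apply, inner_eq_sum, Fin.sum_univ_succ]
    simp [tailBasis_apply_zero, tailBasis_apply_succ, Matrix.one_apply, Matrix.mul_apply, add_comm,
      eq_comm]
  rw [hgram, Matrix.det_one_add_replicateCol_mul_replicateRow]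
  simp [dotProduct, add_comm]

theorem euclideanVolume_eq (n : ℕ) :
    euclideanVolume n = ENNReal.ofReal √((n : ℝ) + 1) • (tailBasis n).addHaar := by
  rw [euclideanVolume, orthonormalBasis_addHaar_eq_smul _ (tailBasis n), det_gram_tailBasis]

theorem isVolumePolynomial_sqrt_mul_gammaSum (n : ℕ) :
    IsVolumePolynomial n (C √((n : ℝ) + 1) * gammaSum n) := by
  intro x hx
  rw [euclideanVolume_eq, measureReal_ennreal_smul_apply,
    tailBasis_addHaar_permutohedron_weightVector hx, eval_mul, eval_C,
    ENNReal.toReal_ofReal (Real.sqrt_nonneg _)]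

theorem IsVolumePolynomial.unique {n : ℕ} {V W : MvPolynomial ℕ ℝ} (hV : IsVolumePolynomial n V)
    (hW : IsVolumePolynomial n W) : V = W := by
  refine funext_set (fun _ => Set.Ici 0) (fun _ => Set.Ici_infinite 0) fun x hx => ?_
  have hnonneg (j : ℕ) (_ : j ∈ Finset.Icc 1 n) : 0 ≤ x j := hx j (Set.mem_univ j)
  rw [hV x hnonneg, hW x hnonneg]

end Hyperplane

end DyckVolume

end

theorem mainTheorem2 (n : ℕ) :
    (∀ D : DyckVolume.DyckPath n, D.cartanProd = 1 / ((n : ℝ) + 1)) ∧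
    (∀ V : MvPolynomial ℕ ℝ, DyckVolume.IsVolumePolynomial n V ↔
      V = MvPolynomial.C (Real.sqrt ((n : ℝ) + 1)) *
        ∑ D : DyckVolume.DyckPath n, D.gammaPoly) ∧
    (∀ μ : MeasureTheory.Measure (DyckVolume.E n), μ.IsAddLeftInvariant →
      μ (parallelepiped (DyckVolume.simpleRoot n)) = 1 →
      ∀ x : ℕ → ℝ, (∀ j ∈ Finset.Icc 1 n, 0 ≤ x j) →
        μ.real (DyckVolume.permutohedron (DyckVolume.weightVector n x)) =
          MvPolynomial.eval x (∑ D : DyckVolume.DyckPath n, D.gammaPoly)) := by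
  refine ⟨fun D => D.cartanProd_eq, fun V => ⟨fun hV => ?_, ?_⟩, fun μ _ hμ x hx => ?_⟩
  · exact hV.unique (DyckVolume.isVolumePolynomial_sqrt_mul_gammaSum n)
  · rintro rfl
    exact DyckVolume.isVolumePolynomial_sqrt_mul_gammaSum n
  · rw [DyckVolume.eq_addHaar_of_parallelepiped_eq_one (DyckVolume.tailBasis n)
      (DyckVolume.abs_det_tailBasis_simpleRoot n) μ hμ]
    exact DyckVolume.tailBasis_addHaar_permutohedron_weightVector hx
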